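/- Let $\mathbf{k}=\mathbb{F}_q$ be a finite field with $q$ elements and let $\mathcal{A}$ be an (essentially small) $\mathbf{k}$-linear abelian category which is finitary, i.e. $\operatorname{Hom}(M,N)$ and $\operatorname{Ext}^1(M,N)$ are finite for all $M,N\in\mathcal{A}$, and hereditary, i.e. $\operatorname{Ext}^n(M,N)=0$ for all $n\ge 2$ and all $M,N\in\mathcal A$. For objects $A,B,M$ let $F^M_{AB}$ be the number of subobjects $S\subseteq M$ with $S\cong B$ and $M/S\cong A$, let $a_M=|\operatorname{Aut}(M)|$, and let $\langle A,B\rangle=\dim_{\mathbf k}\operatorname{Hom}(A,B)-\dim_{\mathbf k}\operatorname{Ext}^1(A,B)$. An object $E$ is called exceptional if $\operatorname{Ext}^1(E,E)=0$ and $\operatorname{End}(E)\cong\mathbf{k}$. A pair $(E_1,E_2)$ of exceptional objects is called orthogonal if $\operatorname{Hom}(E_1,E_2)=0=\operatorname{Hom}(E_2,E_1)$ and $\operatorname{Ext}^1(E_2,E_1)=0$; it is associated to an exceptional object $E$ if there is an exact sequence $0\to E_2\to E\to E_1\to 0$. Let $(E_1,E_2)$ be an orthogonal exceptional pair in $\mathcal{A}$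 associated to an exceptional object $E$. Then for any two objects $X,X'\in\mathcal{A}$, $$F_{X'X}^{E}=\frac{1}{q-1}\sum_{[X_1],[X_2],[X_3],[X_4]}q^{-\langle X_4,X_1\rangle}\,F_{X_3X_1}^{X}\,F_{X_4X_2}^{X'}\,\frac{a_{X_1}a_{X_2}a_{X_3}a_{X_4}}{a_Xa_{X'}}\left(F_{X_2X_1}^{E_2}F_{X_4X_3}^{E_1}-F_{X_2X_1}^{E_1}F_{X_4X_3}^{E_2}\right),$$ where the sum runs over all quadruples of isomorphism classes of objects of $\mathcal{A}$ and has only finitely many nonzero terms. -/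

import Mathlib

open CategoryTheory CategoryTheory.Limits

universe t w v u

namespace HallNumbers

/-- A `k`-linear abelian category is *finitary* if all its morphism spaces and all its
first extension groups are finite sets. -/
structure IsFinitary (C : Type u) [Category.{v} C] [Abelian C] [HasExt.{w} C] : Prop where
  finite_hom : ∀ X Y : C, Finite (X ⟶ Y)
  finite_ext : ∀ X Y : C, Finite (Abelian.Ext X Y 1)

/-- An abelian category is *hereditary* if all its higher extension groups
`Ext^n`, `n ≥ 2`, vanish. -/
def IsHereditary (C : Type u) [Category.{v} C] [Abelian C] [HasExt.{w} C] : Prop :=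
  ∀ (X Y : C) (n : ℕ), 2 ≤ n → Subsingleton (Abelian.Ext X Y n)

/-- An object `E` is *exceptional* if `Ext^1(E, E) = 0` and `End(E) ≅ k` (as `k`-algebras). -/
structure IsExceptional (k : Type t) [Field k] {C : Type u} [Category.{v} C] [Abelian C]
    [Linear k C] [HasExt.{w} C] (E : C) : Prop where
  ext_self : Subsingleton (Abelian.Ext E E 1)
  end_self : Nonempty (End E ≃ₐ[k] k)

/-- `(E₁, E₂)` is an *orthogonal exceptional pair*: both objects are exceptional and
`Hom(E₁, E₂) = 0 = Hom(E₂, E₁)`, `Ext^1(E₂, E₁) = 0`. -/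
structure IsOrthogonalExceptionalPair (k : Type t) [Field k] {C : Type u} [Category.{v} C]
    [Abelian C] [Linear k C] [HasExt.{w} C] (E₁ E₂ : C) : Prop where
  exceptional_fst : IsExceptional k E₁
  exceptional_snd : IsExceptional k E₂
  hom_fst_snd : ∀ f : E₁ ⟶ E₂, f = 0
  hom_snd_fst : ∀ f : E₂ ⟶ E₁, f = 0
  ext_snd_fst : Subsingleton (Abelian.Ext E₂ E₁ 1)

/-- The pair `(E₁, E₂)` is *associated to* `E` if there is a short exact sequence
`0 ⟶ E₂ ⟶ E ⟶ E₁ ⟶ 0`. -/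
def IsAssociatedTo {C : Type u} [Category.{v} C] [Abelian C] (E₁ E₂ E : C) : Prop :=
  ∃ (i : E₂ ⟶ E) (p : E ⟶ E₁) (h : i ≫ p = 0), (ShortComplex.mk i p h).ShortExact

/-- The *Hall number* `F^M_{A B}`: the number of subobjects `S` of `M` with
`S ≅ B` and `M / S ≅ A`. -/
noncomputable def hallNumber {C : Type u} [Category.{v} C] [Abelian C] (A B M : C) : ℕ :=
  Nat.card {S : Subobject M // Nonempty ((S : C) ≅ B) ∧ Nonempty (cokernel S.arrow ≅ A)}

/-- `a_M`, the order of the automorphism group of `M`. -/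
noncomputable def autCard {C : Type u} [Category.{v} C] (M : C) : ℕ :=
  Nat.card (Aut M)

/-- The *Euler form* `⟨A, D⟩ = dim Hom(A, D) - dim Ext^1(A, D)`. -/
noncomputable def eulerForm (k : Type t) [Field k] {C : Type u} [Category.{v} C] [Abelian C]
    [Linear k C] [HasExt.{w} C] (A D : C) : ℤ :=
  (Module.finrank k (A ⟶ D) : ℤ) - (Module.finrank k (Abelian.Ext A D 1) : ℤ)

/-- The set `Iso(C)` of isomorphism classes of objects of `C`. -/
abbrev IsoClass (C : Type u) [Category.{v} C] : Type u :=
  Quotient (isIsomorphicSetoid C)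

/-- The term
`q^{-⟨X₄,X₁⟩} F^X_{X₃X₁} F^{X'}_{X₄X₂} (a_{X₁} a_{X₂} a_{X₃} a_{X₄} / (a_X a_{X'}))
  (F^{E₂}_{X₂X₁} F^{E₁}_{X₄X₃} - F^{E₁}_{X₂X₁} F^{E₂}_{X₄X₃})`, where `q = |k|`. -/
noncomputable def greenTerm (k : Type t) [Field k] {C : Type u} [Category.{v} C] [Abelian C]
    [Linear k C] [HasExt.{w} C] (E₁ E₂ X X' X₁ X₂ X₃ X₄ : C) : ℚ :=
  (Nat.card k : ℚ) ^ (-eulerForm k X₄ X₁)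
    * (hallNumber X₃ X₁ X : ℚ) * (hallNumber X₄ X₂ X' : ℚ)
    * (((autCard X₁ : ℚ) * (autCard X₂ : ℚ) * (autCard X₃ : ℚ) * (autCard X₄ : ℚ))
        / ((autCard X : ℚ) * (autCard X' : ℚ)))
    * ((hallNumber X₂ X₁ E₂ : ℚ) * (hallNumber X₄ X₃ E₁ : ℚ)
        - (hallNumber X₂ X₁ E₁ : ℚ) * (hallNumber X₄ X₃ E₂ : ℚ))

/-- `greenTerm` as a function of four isomorphism classes, evaluated at representatives.
It only depends on the classes, since every ingredient of `greenTerm` is invariant under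
isomorphism. -/
noncomputable def greenSummand (k : Type t) [Field k] {C : Type u} [Category.{v} C] [Abelian C]
    [Linear k C] [HasExt.{w} C] (E₁ E₂ X X' : C)
    (c : IsoClass C × IsoClass C × IsoClass C × IsoClass C) : ℚ :=
  greenTerm k E₁ E₂ X X' c.1.out c.2.1.out c.2.2.1.out c.2.2.2.out

end HallNumbers

namespace HallNumbers

section ShortExactPairs

variable {C : Type u} [Category.{v} C] [Abelian C]

/-- `0 ⟶ N ⟶ E ⟶ M ⟶ 0` is a short exact sequence. -/
def IsSES {N E M : C} (f : N ⟶ E) (g : E ⟶ M) : Prop :=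
  ∃ h : f ≫ g = 0, (ShortComplex.mk f g h).ShortExact

namespace IsSES

variable {N E M : C} {f : N ⟶ E} {g : E ⟶ M}

lemma zero (h : IsSES f g) : f ≫ g = 0 := h.choose

lemma shortExact (h : IsSES f g) : (ShortComplex.mk f g h.zero).ShortExact := h.choose_spec

lemma mono (h : IsSES f g) : Mono f := h.shortExact.mono_f

lemma epi (h : IsSES f g) : Epi g := h.shortExact.epi_g

lemma exists_lift (h : IsSES f g) {T : C} (t : T ⟶ E) (ht : t ≫ g = 0) : ∃ s, s ≫ f = t :=
  have := h.mono
  ⟨h.shortExact.exact.lift t ht, h.shortExact.exact.lift_f t ht⟩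

lemma exists_desc (h : IsSES f g) {T : C} (t : E ⟶ T) (ht : f ≫ t = 0) : ∃ s, g ≫ s = t :=
  have := h.epi
  ⟨h.shortExact.exact.desc t ht, h.shortExact.exact.g_desc t ht⟩

lemma of_lift [Mono f] [Epi g] (h : f ≫ g = 0)
    (hl : ∀ {T : C} (t : T ⟶ E), t ≫ g = 0 → ∃ s, s ≫ f = t) : IsSES f g := by
  refine ⟨h, ?_⟩
  have := ShortComplex.exact_of_f_is_kernel (ShortComplex.mk f g h)
    (KernelFork.IsLimit.ofι' f h fun t ht => ⟨(hl t ht).choose, (hl t ht).choose_spec⟩)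
  exact ⟨this⟩

lemma of_desc [Mono f] [Epi g] (h : f ≫ g = 0)
    (hd : ∀ {T : C} (t : E ⟶ T), f ≫ t = 0 → ∃ s, g ≫ s = t) : IsSES f g := by
  refine ⟨h, ?_⟩
  have := ShortComplex.exact_of_g_is_cokernel (ShortComplex.mk f g h)
    (CokernelCofork.IsColimit.ofπ' g h fun t ht => ⟨(hd t ht).choose, (hd t ht).choose_spec⟩)
  exact ⟨this⟩

lemma isIso_of_hom {N E M E' : C} {f : N ⟶ E} {g : E ⟶ M} {f' : N ⟶ E'} {g' : E' ⟶ M}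
    (h : IsSES f g) (h' : IsSES f' g') (φ : E ⟶ E') (h₁ : f ≫ φ = f') (h₂ : φ ≫ g' = g) :
    IsIso φ := by
  have := h.shortExact
  let F : ShortComplex.mk f g h.zero ⟶ ShortComplex.mk f' g' h'.zero :=
    { τ₁ := 𝟙 _, τ₂ := φ, τ₃ := 𝟙 _ }
  have : IsIso F.τ₁ := by dsimp [F]; infer_instance
  have : IsIso F.τ₃ := by dsimp [F]; infer_instance
  exact ShortComplex.isIso₂_of_shortExact_of_isIso₁₃ F h.shortExact h'.shortExact

lemma comp_iso {N E M E' : C} {f : N ⟶ E} {g : E ⟶ M} (h : IsSES f g) (e : E ≅ E') :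
    IsSES (f ≫ e.hom) (e.inv ≫ g) := by
  have := h.mono
  have := h.epi
  refine of_lift (by simp [h.zero]) fun t ht => ?_
  obtain ⟨s, hs⟩ := h.exists_lift (t ≫ e.inv) (by simpa using ht)
  exact ⟨s, by rw [← Category.assoc, hs]; simp⟩

lemma iso_ends {N E M N' M' : C} {f : N ⟶ E} {g : E ⟶ M} (h : IsSES f g) (e : N' ≅ N)
    (e' : M ≅ M') : IsSES (e.hom ≫ f) (g ≫ e'.hom) := by
  have := h.mono
  have := h.epi
  refine of_lift (by simp [reassoc_of% h.zero]) fun t ht => ?_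
  obtain ⟨s, hs⟩ := h.exists_lift t (by rwa [← Category.assoc, ← cancel_mono e'.inv, Category.assoc,
    e'.hom_inv_id, Category.comp_id, zero_comp] at ht)
  exact ⟨s ≫ e.inv, by simp [hs]⟩

variable [HasExt.{w} C]

/-- The class in `Ext^1` of a short exact sequence. -/
noncomputable def cls (h : IsSES f g) : Abelian.Ext.{w} M N 1 := h.shortExact.extClass

open Abelian Abelian.Ext

lemma cls_comp_f (h : IsSES f g) : h.cls.comp (mk₀ f) (add_zero 1) = 0 :=
  h.shortExact.extClass_comp

lemma comp_cls_g (h : IsSES f g) : (mk₀ g).comp h.cls (zero_add 1) = 0 :=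
  h.shortExact.comp_extClass

variable {N' E' M' : C} {f' : N' ⟶ E'} {g' : E' ⟶ M'}

lemma cls_naturality (h : IsSES f g) (h' : IsSES f' g') {α : N ⟶ N'} {β : M ⟶ M'} {φ : E ⟶ E'}
    (h₁ : f ≫ φ = α ≫ f') (h₂ : φ ≫ g' = g ≫ β) :
    h.cls.comp (mk₀ α) (add_zero 1) = (mk₀ β).comp h'.cls (zero_add 1) :=
  ShortComplex.ShortExact.extClass_naturality h.shortExact h'.shortExact
    { τ₁ := α, τ₂ := φ, τ₃ := β }

lemma exists_hom (h : IsSES f g) (h' : IsSES f' g') (α : N ⟶ N') (β : M ⟶ M')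
    (hc : h.cls.comp (mk₀ α) (add_zero 1) = (mk₀ β).comp h'.cls (zero_add 1)) :
    ∃ φ : E ⟶ E', f ≫ φ = α ≫ f' ∧ φ ≫ g' = g ≫ β := by
  obtain ⟨x, hx⟩ := contravariant_sequence_exact₁ h.shortExact E' (mk₀ (α ≫ f')) (add_zero 1) (by
    change h.cls.comp _ _ = 0
    rw [← mk₀_comp_mk₀, ← comp_assoc_of_third_deg_zero, hc, comp_assoc_of_third_deg_zero,
      h'.cls_comp_f, Abelian.Ext.comp_zero])
  obtain ⟨φ₀, rfl⟩ := (mk₀_bijective _ _).2 x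
  rw [mk₀_comp_mk₀] at hx
  replace hx : f ≫ φ₀ = α ≫ f' := (mk₀_bijective _ _).1 hx
  obtain ⟨β₀, hβ₀⟩ := h.exists_desc (φ₀ ≫ g') (by rw [reassoc_of% hx, h'.zero, Limits.comp_zero])
  have key := h.cls_naturality h' hx hβ₀.symm
  obtain ⟨y, hy⟩ := covariant_sequence_exact₃ M h'.shortExact (mk₀ (β - β₀)) (zero_add 1) (by
    change (mk₀ (β - β₀)).comp h'.cls _ = 0
    rw [sub_eq_add_neg, mk₀_add, add_comp, mk₀_neg, neg_comp, ← key, hc, add_neg_cancel])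
  obtain ⟨s, rfl⟩ := (mk₀_bijective _ _).2 y
  rw [mk₀_comp_mk₀] at hy
  replace hy : s ≫ g' = β - β₀ := (mk₀_bijective _ _).1 hy
  refine ⟨φ₀ + g ≫ s, ?_, ?_⟩
  · simp [hx, reassoc_of% h.zero]
  · rw [Preadditive.add_comp, Category.assoc, hy, ← hβ₀]; simp

omit [HasExt.{w} C] in
lemma card_hom_of_exists (h : IsSES f g) (h' : IsSES f' g') {α : N ⟶ N'} {β : M ⟶ M'} {φ₀ : E ⟶ E'}
    (h₁ : f ≫ φ₀ = α ≫ f') (h₂ : φ₀ ≫ g' = g ≫ β) :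
    Nat.card {φ : E ⟶ E' // f ≫ φ = α ≫ f' ∧ φ ≫ g' = g ≫ β} = Nat.card (M ⟶ N') := by
  symm
  refine Nat.card_congr (Equiv.ofBijective (fun s => ⟨φ₀ + g ≫ s ≫ f', ?_, ?_⟩) ⟨?_, ?_⟩)
  · simp [h₁, reassoc_of% h.zero]
  · simp [h₂, h'.zero]
  · intro s t hst
    have := h.epi
    have := h'.mono
    simpa [cancel_epi, cancel_mono] using hst
  · rintro ⟨φ, h₃, h₄⟩
    obtain ⟨r, hr⟩ := h.exists_desc (φ - φ₀) (by simp [h₁, h₃])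
    have := h.epi
    obtain ⟨s, hs⟩ := h'.exists_lift r (by
      rw [← cancel_epi g, reassoc_of% hr]; simp [h₂, h₄])
    exact ⟨s, by simp [hs, hr]⟩

lemma card_hom (h : IsSES f g) (h' : IsSES f' g') (α : N ⟶ N') (β : M ⟶ M')
    (hc : h.cls.comp (mk₀ α) (add_zero 1) = (mk₀ β).comp h'.cls (zero_add 1)) :
    Nat.card {φ : E ⟶ E' // f ≫ φ = α ≫ f' ∧ φ ≫ g' = g ≫ β} = Nat.card (M ⟶ N') := by
  obtain ⟨φ₀, h₁, h₂⟩ := h.exists_hom h' α β hc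
  exact h.card_hom_of_exists h' h₁ h₂

end IsSES

end ShortExactPairs

section Realization

open Abelian Abelian.Ext Pretriangulated DerivedCategory

variable {C : Type u} [Category.{v} C] [Abelian C] [HasExt.{w} C]

lemma exists_isSES_cls_eq {M N : C} (x : Ext.{w} M N 1) :
    ∃ (E : C) (f : N ⟶ E) (g : E ⟶ M) (h : IsSES f g), h.cls = x := by
  let := HasDerivedCategory.standard C
  obtain ⟨Z, a, b, hT⟩ := distinguished_cocone_triangle₂ (x.hom)
  have : Z.IsLE 0 := TStructure.t.isLE₂ _ hT 0
    (inferInstanceAs (((singleFunctor C 0).obj N).IsLE 0))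
    (inferInstanceAs (((singleFunctor C 0).obj M).IsLE 0))
  have : Z.IsGE 0 := TStructure.t.isGE₂ _ hT 0
    (inferInstanceAs (((singleFunctor C 0).obj N).IsGE 0))
    (inferInstanceAs (((singleFunctor C 0).obj M).IsGE 0))
  obtain ⟨E, ⟨e⟩⟩ := exists_iso_singleFunctor_obj_of_isGE_of_isLE Z 0
  obtain ⟨f, hf⟩ := (singleFunctor C 0).map_surjective (a ≫ e.hom)
  obtain ⟨g, hg⟩ := (singleFunctor C 0).map_surjective (e.inv ≫ b)
  have hT' : Triangle.mk ((singleFunctor C 0).map f) ((singleFunctor C 0).map g) x.hom ∈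
      distTriang (DerivedCategory C) := by
    refine isomorphic_distinguished _ hT _ (Triangle.isoMk _ _ (Iso.refl _) e.symm (Iso.refl _)
      ?_ ?_ ?_)
    · change (singleFunctor C 0).map f ≫ e.inv = 𝟙 _ ≫ a
      simp [hf]
    · change (singleFunctor C 0).map g ≫ 𝟙 _ = e.inv ≫ b
      simp [hg]
    · change x.hom ≫ (𝟙 ((singleFunctor C 0).obj N))⟦(1 : ℤ)⟧' = 𝟙 _ ≫ x.hom
      simp
  have hι : ∀ ⦃X Y : C⦄ ⦃n : ℤ⦄
      (f : (singleFunctor C 0).obj X ⟶ ((singleFunctor C 0).obj Y)⟦n⟧), n < 0 → f = 0 := by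
    intro X Y n f hn
    have := TStructure.t.isGE_shift ((singleFunctor C 0).obj Y) 0 n (-n)
    exact TStructure.t.zero f 0 (-n)
  have hk := Triangulated.AbelianSubcategory.isLimitKernelForkOfDistTriang hι f g _ hT'
  have hc := Triangulated.AbelianSubcategory.isColimitCokernelCoforkOfDistTriang hι f g _ hT'
  have hm : Mono f := mono_of_isLimit_fork hk
  have he : Epi g := epi_of_isColimit_cofork hc
  have hz : f ≫ g = 0 := (singleFunctor C 0).map_injective (by
    rw [Functor.map_comp, Functor.map_zero]
    exact comp_distTriang_mor_zero₁₂ _ hT')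
  have hS : IsSES f g :=
    ⟨hz, ⟨ShortComplex.exact_of_f_is_kernel (ShortComplex.mk f g hz) hk⟩⟩
  refine ⟨E, f, g, hS, ?_⟩
  obtain ⟨c, hc₁, hc₂⟩ := complete_distinguished_triangle_morphism _ _
    hS.shortExact.singleTriangle_distinguished hT' (𝟙 _) (𝟙 _)
    ((Category.comp_id _).trans (Category.id_comp _).symm)
  obtain ⟨c, rfl⟩ := (singleFunctor C 0).map_surjective c
  have hc₃ : c = 𝟙 _ := by
    rw [← cancel_epi g]
    apply (singleFunctor C 0).map_injective
    rw [Functor.map_comp, Category.comp_id]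
    exact hc₁.trans (Category.id_comp _)
  subst hc₃
  apply Abelian.Ext.ext
  rw [IsSES.cls, ShortComplex.ShortExact.extClass_hom]
  change hS.shortExact.singleδ ≫ (𝟙 ((singleFunctor C 0).obj N))⟦(1 : ℤ)⟧' =
    (singleFunctor C 0).map (𝟙 M) ≫ x.hom at hc₂
  simpa using hc₂

end Realization

end HallNumbers

namespace HallNumbers

section Groups

lemma card_eq_card_range_mul_card_range_of_exact {A B D : Type*} [AddCommGroup A] [AddCommGroup B]
    [AddCommGroup D] (f : A →+ B) (g : B →+ D) (h : Function.Exact f g) :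
    Nat.card B = Nat.card f.range * Nat.card g.range := by
  rw [AddSubgroup.card_eq_card_quotient_mul_card_addSubgroup g.ker,
    Nat.card_congr (QuotientAddGroup.quotientKerEquivRange g).toEquiv, mul_comm]
  have : g.ker = f.range := by
    ext x
    exact h x
  rw [this]

lemma card_mul_eq_of_exact_six {A₁ A₂ A₃ A₄ A₅ A₆ : Type*} [AddCommGroup A₁] [AddCommGroup A₂]
    [AddCommGroup A₃] [AddCommGroup A₄] [AddCommGroup A₅] [AddCommGroup A₆]
    (f₁ : A₁ →+ A₂) (f₂ : A₂ →+ A₃) (f₃ : A₃ →+ A₄) (f₄ : A₄ →+ A₅) (f₅ : A₅ →+ A₆)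
    (h₁ : Function.Injective f₁) (h₂ : Function.Exact f₁ f₂) (h₃ : Function.Exact f₂ f₃)
    (h₄ : Function.Exact f₃ f₄) (h₅ : Function.Exact f₄ f₅) (h₆ : Function.Surjective f₅) :
    Nat.card A₁ * Nat.card A₃ * Nat.card A₅ = Nat.card A₂ * Nat.card A₄ * Nat.card A₆ := by
  rw [card_eq_card_range_mul_card_range_of_exact _ _ h₂,
    card_eq_card_range_mul_card_range_of_exact _ _ h₃,
    card_eq_card_range_mul_card_range_of_exact _ _ h₄,
    card_eq_card_range_mul_card_range_of_exact _ _ h₅,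
    Nat.card_congr (Equiv.ofInjective f₁ h₁),
    ← Nat.card_congr (Equiv.Set.univ A₆), ← Set.range_eq_univ.2 h₆]
  change Nat.card f₁.range * _ * _ = _ * _ * Nat.card f₅.range
  ring

lemma card_fiber_mul_card {G H : Type*} [AddCommGroup G] [AddCommGroup H] (φ : G →+ H)
    (hφ : Function.Surjective φ) (y : H) :
    Nat.card {x // φ x = y} * Nat.card H = Nat.card G := by
  obtain ⟨x₀, rfl⟩ := hφ y
  rw [AddSubgroup.card_eq_card_quotient_mul_card_addSubgroup φ.ker,
    Nat.card_congr (QuotientAddGroup.quotientKerEquivOfSurjective φ hφ).toEquiv, mul_comm]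
  congr 1
  exact Nat.card_congr ((Equiv.subRight x₀).subtypeEquiv fun x => by
    simp [AddMonoidHom.mem_ker, sub_eq_zero])

end Groups

open Abelian Abelian.Ext

variable {C : Type u} [Category.{v} C] [Abelian C] [HasExt.{w} C]

lemma card_ext_zero (X Y : C) : Nat.card (Ext.{w} X Y 0) = Nat.card (X ⟶ Y) :=
  Nat.card_congr homEquiv₀

lemma IsHereditary.ext_two_eq_zero (hher : IsHereditary.{w} C) {X Y : C} (x : Ext.{w} X Y 2) :
    x = 0 :=
  (hher X Y 2 le_rfl).elim _ _

namespace IsSES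

variable {N E M : C} {f : N ⟶ E} {g : E ⟶ M}

lemma ext_postcomp_surjective (hher : IsHereditary.{w} C) (h : IsSES f g) (X : C)
    (x : Ext.{w} X M 1) : ∃ y : Ext.{w} X E 1, y.comp (mk₀ g) (add_zero 1) = x :=
  covariant_sequence_exact₃ X h.shortExact x rfl (hher.ext_two_eq_zero _)

lemma ext_precomp_surjective (hher : IsHereditary.{w} C) (h : IsSES f g) (Y : C)
    (x : Ext.{w} N Y 1) : ∃ y : Ext.{w} E Y 1, (mk₀ f).comp y (zero_add 1) = x :=
  contravariant_sequence_exact₁ h.shortExact Y x rfl (hher.ext_two_eq_zero _)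

lemma card_covariant (hher : IsHereditary.{w} C) (h : IsSES f g) (X : C) :
    Nat.card (X ⟶ N) * Nat.card (X ⟶ M) * Nat.card (Ext.{w} X E 1) =
      Nat.card (X ⟶ E) * Nat.card (Ext.{w} X N 1) * Nat.card (Ext.{w} X M 1) := by
  have := h.mono
  simp only [← card_ext_zero.{w}]
  exact card_mul_eq_of_exact_six ((mk₀ f).postcomp X (add_zero 0)) ((mk₀ g).postcomp X (add_zero 0))
    (h.shortExact.extClass.postcomp X (zero_add 1)) ((mk₀ f).postcomp X (add_zero 1))
    ((mk₀ g).postcomp X (add_zero 1))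
    (postcomp_mk₀_injective_of_mono X f)
    ((ShortComplex.ab_exact_iff_function_exact _).1 (covariant_sequence_exact₂' X h.shortExact 0))
    ((ShortComplex.ab_exact_iff_function_exact _).1
      (covariant_sequence_exact₃' X h.shortExact 0 1 (zero_add 1)))
    ((ShortComplex.ab_exact_iff_function_exact _).1
      (covariant_sequence_exact₁' X h.shortExact 0 1 (zero_add 1)))
    ((ShortComplex.ab_exact_iff_function_exact _).1 (covariant_sequence_exact₂' X h.shortExact 1))
    (h.ext_postcomp_surjective hher X)

lemma card_contravariant (hher : IsHereditary.{w} C) (h : IsSES f g) (Y : C) :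
    Nat.card (M ⟶ Y) * Nat.card (N ⟶ Y) * Nat.card (Ext.{w} E Y 1) =
      Nat.card (E ⟶ Y) * Nat.card (Ext.{w} M Y 1) * Nat.card (Ext.{w} N Y 1) := by
  have := h.epi
  simp only [← card_ext_zero.{w}]
  exact card_mul_eq_of_exact_six ((mk₀ g).precomp Y (zero_add 0)) ((mk₀ f).precomp Y (zero_add 0))
    (h.shortExact.extClass.precomp Y (add_zero 1)) ((mk₀ g).precomp Y (zero_add 1))
    ((mk₀ f).precomp Y (zero_add 1))
    (precomp_mk₀_injective_of_epi Y g)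
    ((ShortComplex.ab_exact_iff_function_exact _).1
      (contravariant_sequence_exact₂' h.shortExact Y 0))
    ((ShortComplex.ab_exact_iff_function_exact _).1
      (contravariant_sequence_exact₁' h.shortExact Y 0 1 (add_zero 1)))
    ((ShortComplex.ab_exact_iff_function_exact _).1
      (contravariant_sequence_exact₃' h.shortExact Y 0 1 (add_zero 1)))
    ((ShortComplex.ab_exact_iff_function_exact _).1
      (contravariant_sequence_exact₂' h.shortExact Y 1))
    (h.ext_precomp_surjective hher Y)

end IsSES

/-- The multiplicative Euler form `|Hom(A, D)| / |Ext^1(A, D)|`. -/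
noncomputable def eulerRatio (A D : C) : ℚ :=
  (Nat.card (A ⟶ D) : ℚ) / Nat.card (Ext.{w} A D 1)

namespace IsFinitary

variable (hfin : IsFinitary.{w} C)
include hfin

lemma card_hom_ne_zero (A D : C) : (Nat.card (A ⟶ D) : ℚ) ≠ 0 := by
  have := hfin.finite_hom A D
  exact_mod_cast Nat.card_pos.ne'

lemma card_ext_ne_zero (A D : C) : (Nat.card (Ext.{w} A D 1) : ℚ) ≠ 0 := by
  have := hfin.finite_ext A D
  exact_mod_cast Nat.card_pos.ne'

lemma card_zpow_eulerForm (k : Type t) [Field k] [Finite k] [Linear k C] (A D : C) :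
    (Nat.card k : ℚ) ^ eulerForm.{t, w} k A D = eulerRatio.{w} A D := by
  have := hfin.finite_hom A D
  have := hfin.finite_ext A D
  have h0 : (Nat.card k : ℚ) ≠ 0 := by exact_mod_cast Nat.card_pos.ne'
  rw [eulerForm, eulerRatio, zpow_sub₀ h0, zpow_natCast, zpow_natCast,
    Module.natCard_eq_pow_finrank (K := k) (V := A ⟶ D),
    Module.natCard_eq_pow_finrank (K := k) (V := Ext A D 1)]
  push_cast
  rfl

lemma eulerRatio_covariant (hher : IsHereditary.{w} C) {N E M : C} {f : N ⟶ E} {g : E ⟶ M}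
    (h : IsSES f g) (X : C) :
    eulerRatio.{w} X E = eulerRatio.{w} X N * eulerRatio.{w} X M := by
  have := h.card_covariant hher X
  have h₁ := hfin.card_ext_ne_zero X N
  have h₂ := hfin.card_ext_ne_zero X E
  have h₃ := hfin.card_ext_ne_zero X M
  unfold eulerRatio
  field_simp
  exact_mod_cast (by linarith : _ = _)

lemma eulerRatio_contravariant (hher : IsHereditary.{w} C) {N E M : C} {f : N ⟶ E} {g : E ⟶ M}
    (h : IsSES f g) (Y : C) :
    eulerRatio.{w} E Y = eulerRatio.{w} M Y * eulerRatio.{w} N Y := by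
  have := h.card_contravariant hher Y
  have h₁ := hfin.card_ext_ne_zero N Y
  have h₂ := hfin.card_ext_ne_zero E Y
  have h₃ := hfin.card_ext_ne_zero M Y
  unfold eulerRatio
  field_simp
  exact_mod_cast (by linarith : _ = _)

end IsFinitary

end HallNumbers

namespace HallNumbers

variable {C : Type u} [Category.{v} C] [Abelian C]

/-- The set of short exact sequences `0 ⟶ N ⟶ E ⟶ M ⟶ 0` with fixed objects. -/
def SES (N E M : C) : Type v := {p : (N ⟶ E) × (E ⟶ M) // IsSES p.1 p.2}

lemma isSES_arrow_cokernel {M : C} (S : Subobject M) : IsSES S.arrow (cokernel.π S.arrow) :=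
  IsSES.of_desc (cokernel.condition _) fun t ht => ⟨cokernel.desc _ t ht, cokernel.π_desc _ t ht⟩

lemma card_SES (A B M : C) :
    Nat.card (SES B M A) = hallNumber A B M * autCard A * autCard B := by
  unfold hallNumber autCard
  rw [← Nat.card_prod, ← Nat.card_prod]
  symm
  let α (S : {S : Subobject M // Nonempty ((S : C) ≅ B) ∧ Nonempty (cokernel S.arrow ≅ A)}) :
    (S.1 : C) ≅ B := S.2.1.some
  let β (S : {S : Subobject M // Nonempty ((S : C) ≅ B) ∧ Nonempty (cokernel S.arrow ≅ A)}) :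
    cokernel S.1.arrow ≅ A := S.2.2.some
  refine Nat.card_congr (Equiv.ofBijective (fun x =>
    ⟨((x.2 ≪≫ (α x.1.1).symm).hom ≫ x.1.1.1.arrow,
      cokernel.π x.1.1.1.arrow ≫ (β x.1.1 ≪≫ x.1.2).hom),
      (isSES_arrow_cokernel x.1.1.1).iso_ends _ _⟩) ⟨?_, ?_⟩)
  · rintro ⟨⟨S, τ⟩, σ⟩ ⟨⟨S', τ'⟩, σ'⟩ h
    have h₁ := congrArg (fun p => p.1.1) h
    have h₂ := congrArg (fun p => p.1.2) h
    dsimp only at h₁ h₂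
    have hS : S = S' := by
      ext1
      rw [← Subobject.mk_arrow S.1, ← Subobject.mk_arrow S'.1]
      refine Subobject.mk_eq_mk_of_comm _ _
        ((σ ≪≫ (α S).symm).symm ≪≫ σ' ≪≫ (α S').symm) ?_
      simp only [Iso.trans_hom, Iso.symm_hom, Category.assoc] at h₁ ⊢
      rw [← h₁]
      simp
    subst hS
    have hσ : σ = σ' := by
      have h₁' : (σ.hom ≫ (α S).inv) ≫ S.1.arrow = (σ'.hom ≫ (α S).inv) ≫ S.1.arrow := h₁
      rw [cancel_mono, cancel_mono] at h₁'
      exact Iso.ext h₁'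
    have hτ : τ = τ' := by
      have h₂' : cokernel.π S.1.arrow ≫ (β S).hom ≫ τ.hom =
        cokernel.π S.1.arrow ≫ (β S).hom ≫ τ'.hom := h₂
      rw [cancel_epi, cancel_epi] at h₂'
      exact Iso.ext h₂'
    rw [hσ, hτ]
  · rintro ⟨⟨f, g⟩, h⟩
    dsimp only at h
    have := h.mono
    have := h.epi
    let i := Subobject.underlyingIso f
    have hi : i.inv ≫ (Subobject.mk f).arrow = f := by simp [i]
    have hi' : i.hom ≫ f = (Subobject.mk f).arrow := by simp [i]
    obtain ⟨s, hs⟩ := h.exists_desc (cokernel.π (Subobject.mk f).arrow) (by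
      have := i.inv ≫= cokernel.condition (Subobject.mk f).arrow
      rwa [reassoc_of% hi, comp_zero] at this)
    let t : cokernel (Subobject.mk f).arrow ≅ A :=
      { hom := cokernel.desc _ g (by rw [← hi', Category.assoc, h.zero, comp_zero])
        inv := s
        hom_inv_id := by
          rw [← cancel_epi (cokernel.π _)]
          simp [hs]
        inv_hom_id := by
          rw [← cancel_epi g, reassoc_of% hs]
          simp }
    let S : {S : Subobject M // Nonempty ((S : C) ≅ B) ∧ Nonempty (cokernel S.arrow ≅ A)} :=
      ⟨Subobject.mk f, ⟨i⟩, ⟨t⟩⟩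
    refine ⟨⟨⟨S, (β S).symm ≪≫ t⟩, i.symm ≪≫ α S⟩, ?_⟩
    apply Subtype.ext
    refine Prod.ext ?_ ?_
    · simp [S, i]
    · simp [S, t]

lemma card_SES_congr_mid (N M : C) {E E' : C} (e : E ≅ E') :
    Nat.card (SES N E M) = Nat.card (SES N E' M) :=
  Nat.card_congr
    { toFun := fun p => ⟨(p.1.1 ≫ e.hom, e.inv ≫ p.1.2), p.2.comp_iso e⟩
      invFun := fun p => ⟨(p.1.1 ≫ e.inv, e.hom ≫ p.1.2), p.2.comp_iso e.symm⟩
      left_inv := fun p => Subtype.ext (Prod.ext (by simp) (by simp))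
      right_inv := fun p => Subtype.ext (Prod.ext (by simp) (by simp)) }

/-- The boundary of a `3 × 3` diagram of short exact sequences
with corners `X₁`, `X₂`, `X₃`, `X₄`. -/
@[ext]
structure Frame (N M X X' X₁ X₂ X₃ X₄ : C) where
  a : X₁ ⟶ N
  b : N ⟶ X₂
  c : X₃ ⟶ M
  d : M ⟶ X₄
  e : X₁ ⟶ X
  h : X ⟶ X₃
  m : X₂ ⟶ X'
  n : X' ⟶ X₄
  hab : IsSES a b
  hcd : IsSES c d
  heh : IsSES e h
  hmn : IsSES m n

namespace Frame

variable {N M X X' X₁ X₂ X₃ X₄ Y₁ Y₂ Y₃ Y₄ E : C}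

/-- A frame consists of four short exact sequences. -/
def equivProd (N M X X' X₁ X₂ X₃ X₄ : C) :
    Frame N M X X' X₁ X₂ X₃ X₄ ≃ SES X₁ N X₂ × SES X₃ M X₄ × SES X₁ X X₃ × SES X₂ X' X₄ where
  toFun D := ⟨⟨(D.a, D.b), D.hab⟩, ⟨(D.c, D.d), D.hcd⟩, ⟨(D.e, D.h), D.heh⟩, ⟨(D.m, D.n), D.hmn⟩⟩
  invFun p := ⟨p.1.1.1, p.1.1.2, p.2.1.1.1, p.2.1.1.2, p.2.2.1.1.1, p.2.2.1.1.2, p.2.2.2.1.1,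
    p.2.2.2.1.2, p.1.2, p.2.1.2, p.2.2.1.2, p.2.2.2.2⟩

/-- The frame `D` is completed to a commutative `3 × 3` diagram by `f`, `g`, `f'`, `g'`. -/
structure Completes (D : Frame N M X X' X₁ X₂ X₃ X₄) (f : N ⟶ E) (g : E ⟶ M) (f' : X ⟶ E)
    (g' : E ⟶ X') : Prop where
  af : D.a ≫ f = D.e ≫ f'
  gd : g ≫ D.d = g' ≫ D.n
  fg' : f' ≫ g = D.h ≫ D.c
  gf' : f ≫ g' = D.b ≫ D.m

/-- Change the corners of a frame along isomorphisms. -/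
@[simps]
def transport (D : Frame N M X X' X₁ X₂ X₃ X₄) (φ₁ : Y₁ ≅ X₁) (φ₂ : Y₂ ≅ X₂) (φ₃ : Y₃ ≅ X₃)
    (φ₄ : Y₄ ≅ X₄) : Frame N M X X' Y₁ Y₂ Y₃ Y₄ where
  a := φ₁.hom ≫ D.a
  b := D.b ≫ φ₂.inv
  c := φ₃.hom ≫ D.c
  d := D.d ≫ φ₄.inv
  e := φ₁.hom ≫ D.e
  h := D.h ≫ φ₃.inv
  m := φ₂.hom ≫ D.m
  n := D.n ≫ φ₄.inv
  hab := D.hab.iso_ends φ₁ φ₂.symm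
  hcd := D.hcd.iso_ends φ₃ φ₄.symm
  heh := D.heh.iso_ends φ₁ φ₃.symm
  hmn := D.hmn.iso_ends φ₂ φ₄.symm

namespace Completes

variable {f : N ⟶ E} {g : E ⟶ M} {f' : X ⟶ E} {g' : E ⟶ X'}

lemma transport {D : Frame N M X X' X₁ X₂ X₃ X₄} (hD : D.Completes f g f' g') (φ₁ : Y₁ ≅ X₁)
    (φ₂ : Y₂ ≅ X₂) (φ₃ : Y₃ ≅ X₃) (φ₄ : Y₄ ≅ X₄) :
    (D.transport φ₁ φ₂ φ₃ φ₄).Completes f g f' g' where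
  af := by simp [hD.af]
  gd := by simp [reassoc_of% hD.gd]
  fg' := by simp [hD.fg']
  gf' := by simp [hD.gf']

lemma exists_comparison {D : Frame N M X X' X₁ X₂ X₃ X₄} {D' : Frame N M X X' Y₁ Y₂ Y₃ Y₄}
    (hD : D.Completes f g f' g') (hD' : D'.Completes f g f' g') (hf' : Mono f') (hg' : Epi g') :
    ∃ (φ₁ : X₁ ⟶ Y₁) (φ₂ : X₂ ⟶ Y₂) (φ₃ : X₃ ⟶ Y₃) (φ₄ : X₄ ⟶ Y₄),
      φ₁ ≫ D'.a = D.a ∧ D.b ≫ φ₂ = D'.b ∧ φ₃ ≫ D'.c = D.c ∧ D.d ≫ φ₄ = D'.d ∧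
      φ₁ ≫ D'.e = D.e ∧ D.h ≫ φ₃ = D'.h ∧ φ₂ ≫ D'.m = D.m ∧ D.n ≫ φ₄ = D'.n := by
  have := D'.hmn.mono
  have := D.hab.epi
  have := D.heh.epi
  obtain ⟨φ₁, h₁⟩ := D'.hab.exists_lift D.a (by
    rw [← cancel_mono D'.m, Category.assoc, ← hD'.gf', hD.gf', reassoc_of% D.hab.zero, zero_comp,
      zero_comp])
  have h₁' : φ₁ ≫ D'.e = D.e := by
    rw [← cancel_mono f', Category.assoc, ← hD'.af, reassoc_of% h₁, hD.af]
  obtain ⟨φ₂, h₂⟩ := D.hab.exists_desc D'.b (by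
    rw [← h₁, Category.assoc, D'.hab.zero, comp_zero])
  have h₂' : φ₂ ≫ D'.m = D.m := by
    rw [← cancel_epi D.b, reassoc_of% h₂, ← hD'.gf', hD.gf']
  obtain ⟨φ₃, h₃⟩ := D.heh.exists_desc D'.h (by
    rw [← h₁', Category.assoc, D'.heh.zero, comp_zero])
  have h₃' : φ₃ ≫ D'.c = D.c := by
    rw [← cancel_epi D.h, reassoc_of% h₃, ← hD'.fg', hD.fg']
  obtain ⟨φ₄, h₄⟩ := D.hcd.exists_desc D'.d (by
    rw [← h₃', Category.assoc, D'.hcd.zero, comp_zero])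
  have h₄' : D.n ≫ φ₄ = D'.n := by
    rw [← cancel_epi g', ← hD'.gd, ← h₄, reassoc_of% hD.gd]
  exact ⟨φ₁, φ₂, φ₃, φ₄, h₁, h₂, h₃', h₄, h₁', h₃, h₂', h₄'⟩

lemma exists_iso {D : Frame N M X X' X₁ X₂ X₃ X₄} {D' : Frame N M X X' Y₁ Y₂ Y₃ Y₄}
    (hD : D.Completes f g f' g') (hD' : D'.Completes f g f' g') (hf' : Mono f') (hg' : Epi g') :
    ∃ (φ₁ : X₁ ≅ Y₁) (φ₂ : X₂ ≅ Y₂) (φ₃ : X₃ ≅ Y₃) (φ₄ : X₄ ≅ Y₄),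
      D = D'.transport φ₁ φ₂ φ₃ φ₄ := by
  obtain ⟨φ₁, φ₂, φ₃, φ₄, h₁, h₂, h₃, h₄, h₅, h₆, h₇, h₈⟩ := hD.exists_comparison hD' hf' hg'
  obtain ⟨ψ₁, ψ₂, ψ₃, ψ₄, k₁, k₂, k₃, k₄, k₅, k₆, k₇, k₈⟩ := hD'.exists_comparison hD hf' hg'
  have := D.hab.mono
  have := D'.hab.mono
  have := D.hab.epi
  have := D'.hab.epi
  have := D.hcd.mono
  have := D'.hcd.mono
  have := D.hcd.epi
  have := D'.hcd.epi
  refine ⟨⟨φ₁, ψ₁, ?_, ?_⟩, ⟨φ₂, ψ₂, ?_, ?_⟩, ⟨φ₃, ψ₃, ?_, ?_⟩, ⟨φ₄, ψ₄, ?_, ?_⟩, ?_⟩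
  · simp [← cancel_mono D.a, k₁, h₁]
  · simp [← cancel_mono D'.a, k₁, h₁]
  · simp [← cancel_epi D.b, reassoc_of% h₂, k₂]
  · simp [← cancel_epi D'.b, reassoc_of% k₂, h₂]
  · simp [← cancel_mono D.c, k₃, h₃]
  · simp [← cancel_mono D'.c, k₃, h₃]
  · simp [← cancel_epi D.d, reassoc_of% h₄, k₄]
  · simp [← cancel_epi D'.d, reassoc_of% k₄, h₄]
  · ext <;> simp [*]

lemma card_completes {D₀ : Frame N M X X' X₁ X₂ X₃ X₄} (hD₀ : D₀.Completes f g f' g')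
    (hf' : Mono f') (hg' : Epi g') :
    Nat.card {D : Frame N M X X' X₁ X₂ X₃ X₄ // D.Completes f g f' g'} =
      autCard X₁ * autCard X₂ * autCard X₃ * autCard X₄ := by
  unfold autCard
  rw [← Nat.card_prod, ← Nat.card_prod, ← Nat.card_prod]
  symm
  refine Nat.card_congr (Equiv.ofBijective (fun φ => ⟨D₀.transport φ.1.1.1 φ.1.1.2 φ.1.2 φ.2,
    hD₀.transport _ _ _ _⟩) ⟨?_, ?_⟩)
  · rintro ⟨⟨⟨φ₁, φ₂⟩, φ₃⟩, φ₄⟩ ⟨⟨⟨ψ₁, ψ₂⟩, ψ₃⟩, ψ₄⟩ hφ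
    replace hφ := congrArg Subtype.val hφ
    have h₁ : φ₁.hom ≫ D₀.a = ψ₁.hom ≫ D₀.a := congrArg Frame.a hφ
    have h₂ : φ₂.hom ≫ D₀.m = ψ₂.hom ≫ D₀.m := congrArg Frame.m hφ
    have h₃ : φ₃.hom ≫ D₀.c = ψ₃.hom ≫ D₀.c := congrArg Frame.c hφ
    have h₄ : D₀.d ≫ φ₄.inv = D₀.d ≫ ψ₄.inv := congrArg Frame.d hφ
    have := D₀.hab.mono
    have := D₀.hmn.mono
    have := D₀.hcd.mono
    have := D₀.hcd.epi
    rw [cancel_mono] at h₁ h₂ h₃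
    rw [cancel_epi] at h₄
    rw [show φ₁ = ψ₁ from Iso.ext h₁, show φ₂ = ψ₂ from Iso.ext h₂, show φ₃ = ψ₃ from Iso.ext h₃,
      show φ₄ = ψ₄ from Iso.ext_inv h₄]
  · rintro ⟨D, hD⟩
    obtain ⟨φ₁, φ₂, φ₃, φ₄, h⟩ := hD.exists_iso hD₀ hf' hg'
    exact ⟨⟨⟨⟨φ₁, φ₂⟩, φ₃⟩, φ₄⟩, Subtype.ext h.symm⟩

end Completes

lemma exists_completes {f : N ⟶ E} {g : E ⟶ M} {f' : X ⟶ E} {g' : E ⟶ X'} (hfg : IsSES f g)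
    (hfg' : IsSES f' g') :
    ∃ (X₁ X₂ X₃ X₄ : C) (D : Frame N M X X' X₁ X₂ X₃ X₄), D.Completes f g f' g' := by
  have := hfg.mono
  have := hfg.epi
  have := hfg'.mono
  have := hfg'.epi
  obtain ⟨e, he⟩ := hfg'.exists_lift (kernel.ι (f ≫ g') ≫ f) (by simp)
  obtain ⟨n, hn⟩ := hfg'.exists_desc (g ≫ cokernel.π (f' ≫ g)) (by
    rw [← Category.assoc, cokernel.condition])
  have hm := image.fac (f ≫ g')
  have hc := image.fac (f' ≫ g)
  have : Mono (e ≫ f') := by rw [he]; infer_instance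
  have : Mono e := mono_of_mono e f'
  have : Epi (g' ≫ n) := by rw [hn]; infer_instance
  have : Epi n := epi_of_epi g' n
  refine ⟨kernel (f ≫ g'), image (f ≫ g'), image (f' ≫ g), cokernel (f' ≫ g),
    ⟨kernel.ι _, factorThruImage _, image.ι _, cokernel.π _, e, factorThruImage _, image.ι _, n,
      ?_, ?_, ?_, ?_⟩, ⟨he.symm, hn.symm, hc.symm, hm.symm⟩⟩
  · refine IsSES.of_lift ?_ fun t ht => ⟨kernel.lift _ t ?_, kernel.lift_ι _ _ _⟩
    · rw [← cancel_mono (image.ι _), Category.assoc, hm, kernel.condition, zero_comp]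
    · rw [← hm, reassoc_of% ht, zero_comp]
  · refine IsSES.of_desc ?_ fun t ht => ⟨cokernel.desc _ t ?_, cokernel.π_desc _ _ _⟩
    · rw [← cancel_epi (factorThruImage _), reassoc_of% hc, ← Category.assoc, cokernel.condition,
        comp_zero]
    · rw [← hc, Category.assoc, ht, comp_zero]
  · refine IsSES.of_lift ?_ fun t ht => ?_
    · rw [← cancel_mono (image.ι _), Category.assoc, hc, reassoc_of% he, hfg.zero, comp_zero,
        zero_comp]
    · have h₀ : t ≫ f' ≫ g = 0 := by rw [← hc, reassoc_of% ht, zero_comp]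
      obtain ⟨s, hs⟩ := hfg.exists_lift (t ≫ f') (by simpa using h₀)
      refine ⟨kernel.lift _ s (by rw [reassoc_of% hs, hfg'.zero, comp_zero]), ?_⟩
      rw [← cancel_mono f', Category.assoc, he, kernel.lift_ι_assoc, hs]
  · refine IsSES.of_desc ?_ fun t ht => ?_
    · rw [← cancel_epi (factorThruImage _), reassoc_of% hm, hn, reassoc_of% hfg.zero, zero_comp,
        comp_zero]
    · have h₀ : f ≫ g' ≫ t = 0 := by rw [← Category.assoc, ← hm, Category.assoc, ht, comp_zero]
      obtain ⟨s, hs⟩ := hfg.exists_desc (g' ≫ t) h₀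
      refine ⟨cokernel.desc _ s (by rw [Category.assoc, hs, reassoc_of% hfg'.zero, zero_comp]), ?_⟩
      rw [← cancel_epi g', reassoc_of% hn, cokernel.π_desc, hs]

end Frame

end HallNumbers

namespace HallNumbers

open Abelian

variable {C : Type u} [Category.{v} C] [Abelian C]

section Realization

variable [HasExt.{w} C] {M N : C} (x : Ext.{w} M N 1)

/-- The middle term of an extension with a given class. -/
noncomputable def extMid : C := (exists_isSES_cls_eq x).choose

/-- The inclusion of an extension with a given class. -/
noncomputable def extι : N ⟶ extMid x := (exists_isSES_cls_eq x).choose_spec.choose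

/-- The projection of an extension with a given class. -/
noncomputable def extπ : extMid x ⟶ M := (exists_isSES_cls_eq x).choose_spec.choose_spec.choose

lemma isSES_ext : IsSES (extι x) (extπ x) :=
  (exists_isSES_cls_eq x).choose_spec.choose_spec.choose_spec.choose

lemma cls_isSES_ext : (isSES_ext x).cls = x :=
  (exists_isSES_cls_eq x).choose_spec.choose_spec.choose_spec.choose_spec

namespace IsSES

variable {E E' : C} {f : N ⟶ E} {g : E ⟶ M} {f' : N ⟶ E'} {g' : E' ⟶ M}

omit x in
lemma cls_eq_of_hom (h : IsSES f g) (h' : IsSES f' g') (φ : E ⟶ E') (h₁ : f ≫ φ = f')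
    (h₂ : φ ≫ g' = g) : h.cls = h'.cls := by
  simpa using h.cls_naturality h' (α := 𝟙 _) (β := 𝟙 _) (φ := φ) (by simpa) (by simpa)

omit x in
lemma card_iso (h : IsSES f g) (h' : IsSES f' g') (hc : h.cls = h'.cls) :
    Nat.card {φ : E ≅ E' // f ≫ φ.hom = f' ∧ φ.hom ≫ g' = g} = Nat.card (M ⟶ N) := by
  rw [← h.card_hom h' (𝟙 _) (𝟙 _) (by simpa)]
  refine Nat.card_congr
    { toFun := fun φ => ⟨φ.1.hom, by simpa using φ.2⟩
      invFun := fun φ =>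
        have := h.isIso_of_hom h' φ.1 (by simpa using φ.2.1) (by simpa using φ.2.2)
        ⟨asIso φ.1, by simpa using φ.2⟩
      left_inv := fun φ => Subtype.ext (Iso.ext rfl)
      right_inv := fun φ => rfl }

omit x in
lemma nonempty_iso (h : IsSES f g) (h' : IsSES f' g') (hc : h.cls = h'.cls) :
    Nonempty (E ≅ E') := by
  obtain ⟨φ, h₁, h₂⟩ := h.exists_hom h' (𝟙 _) (𝟙 _) (by simpa)
  have := h.isIso_of_hom h' φ (by simpa using h₁) (by simpa using h₂)
  exact ⟨asIso φ⟩

omit x in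
lemma sum_card_iso_left [Fintype (Ext.{w} M N 1)] (h : IsSES f g) :
    ∑ y : Ext.{w} M N 1,
      Nat.card {φ : E ≅ extMid y // f ≫ φ.hom = extι y ∧ φ.hom ≫ extπ y = g} =
      Nat.card (M ⟶ N) := by
  rw [Finset.sum_eq_single h.cls]
  · exact h.card_iso (isSES_ext _) (cls_isSES_ext _).symm
  · intro y _ hy
    have : IsEmpty {φ : E ≅ extMid y // f ≫ φ.hom = extι y ∧ φ.hom ≫ extπ y = g} :=
      ⟨fun φ => hy (by rw [h.cls_eq_of_hom (isSES_ext y) φ.1.hom φ.2.1 φ.2.2, cls_isSES_ext])⟩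
    exact Nat.card_of_isEmpty
  · simp

omit x in
lemma sum_card_iso_right [Fintype (Ext.{w} M N 1)] (h : IsSES f g) :
    ∑ y : Ext.{w} M N 1,
      Nat.card {φ : extMid y ≅ E // extι y ≫ φ.hom = f ∧ φ.hom ≫ g = extπ y} =
      Nat.card (M ⟶ N) := by
  rw [Finset.sum_eq_single h.cls]
  · exact (isSES_ext _).card_iso h (cls_isSES_ext _)
  · intro y _ hy
    have : IsEmpty {φ : extMid y ≅ E // extι y ≫ φ.hom = f ∧ φ.hom ≫ g = extπ y} :=
      ⟨fun φ => hy (by rw [← (isSES_ext y).cls_eq_of_hom h φ.1.hom φ.2.1 φ.2.2, cls_isSES_ext])⟩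
    exact Nat.card_of_isEmpty
  · simp

end IsSES

end Realization

namespace Frame

variable {N M X X' X₁ X₂ X₃ X₄ E E' : C} (D : Frame N M X X' X₁ X₂ X₃ X₄)

/-- The pushout of `N` and `X` over `X₁`. -/
noncomputable def glue : C := pushout D.a D.e

/-- The inclusion of `N` in the pushout. -/
noncomputable def inl : N ⟶ D.glue := pushout.inl D.a D.e

/-- The inclusion of `X` in the pushout. -/
noncomputable def inr : X ⟶ D.glue := pushout.inr D.a D.e

lemma a_inl : D.a ≫ D.inl = D.e ≫ D.inr := pushout.condition

lemma a_inl_assoc {T : C} (t : D.glue ⟶ T) : D.a ≫ D.inl ≫ t = D.e ≫ D.inr ≫ t := by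
  rw [← Category.assoc, a_inl, Category.assoc]

/-- The universal property of the pushout. -/
noncomputable def desc {T : C} (s : N ⟶ T) (t : X ⟶ T) (h : D.a ≫ s = D.e ≫ t) : D.glue ⟶ T :=
  pushout.desc s t h

@[simp]
lemma inl_desc {T : C} (s : N ⟶ T) (t : X ⟶ T) (h : D.a ≫ s = D.e ≫ t) :
    D.inl ≫ D.desc s t h = s := pushout.inl_desc ..

@[simp]
lemma inl_desc_assoc {T T' : C} (s : N ⟶ T) (t : X ⟶ T) (h : D.a ≫ s = D.e ≫ t) (r : T ⟶ T') :
    D.inl ≫ D.desc s t h ≫ r = s ≫ r := by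
  rw [← Category.assoc, inl_desc]

@[simp]
lemma inr_desc {T : C} (s : N ⟶ T) (t : X ⟶ T) (h : D.a ≫ s = D.e ≫ t) :
    D.inr ≫ D.desc s t h = t := pushout.inr_desc ..

@[simp]
lemma inr_desc_assoc {T T' : C} (s : N ⟶ T) (t : X ⟶ T) (h : D.a ≫ s = D.e ≫ t) (r : T ⟶ T') :
    D.inr ≫ D.desc s t h ≫ r = t ≫ r := by
  rw [← Category.assoc, inr_desc]

variable {D} in
lemma glue_hom_ext {T : C} {s t : D.glue ⟶ T} (h₁ : D.inl ≫ s = D.inl ≫ t)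
    (h₂ : D.inr ≫ s = D.inr ≫ t) : s = t :=
  pushout.hom_ext h₁ h₂

/-- The projection of the pushout to `X₂`. -/
noncomputable def toTwo : D.glue ⟶ X₂ := D.desc D.b 0 (by rw [D.hab.zero, comp_zero])

/-- The projection of the pushout to `X₃`. -/
noncomputable def toThree : D.glue ⟶ X₃ := D.desc 0 D.h (by rw [D.heh.zero, comp_zero])

@[simp]
lemma inl_toTwo : D.inl ≫ D.toTwo = D.b := by simp [toTwo]

@[simp]
lemma inl_toTwo_assoc {T : C} (t : X₂ ⟶ T) : D.inl ≫ D.toTwo ≫ t = D.b ≫ t := by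
  rw [← Category.assoc, inl_toTwo]

@[simp]
lemma inr_toTwo : D.inr ≫ D.toTwo = 0 := by simp [toTwo]

@[simp]
lemma inr_toTwo_assoc {T : C} (t : X₂ ⟶ T) : D.inr ≫ D.toTwo ≫ t = 0 := by
  rw [← Category.assoc, inr_toTwo, zero_comp]

@[simp]
lemma inl_toThree : D.inl ≫ D.toThree = 0 := by simp [toThree]

@[simp]
lemma inl_toThree_assoc {T : C} (t : X₃ ⟶ T) : D.inl ≫ D.toThree ≫ t = 0 := by
  rw [← Category.assoc, inl_toThree, zero_comp]

@[simp]
lemma inr_toThree : D.inr ≫ D.toThree = D.h := by simp [toThree]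

@[simp]
lemma inr_toThree_assoc {T : C} (t : X₃ ⟶ T) : D.inr ≫ D.toThree ≫ t = D.h ≫ t := by
  rw [← Category.assoc, inr_toThree]

lemma isSES_inl_toThree : IsSES D.inl D.toThree := by
  have := D.heh.mono
  have := D.heh.epi
  have : Mono D.inl := inferInstanceAs (Mono (pushout.inl D.a D.e))
  have : Epi (D.inr ≫ D.toThree) := by rw [D.inr_toThree]; infer_instance
  have : Epi D.toThree := epi_of_epi D.inr _
  refine IsSES.of_desc D.inl_toThree fun t ht => ?_
  obtain ⟨s, hs⟩ := D.heh.exists_desc (D.inr ≫ t) (by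
    rw [← a_inl_assoc, ht, comp_zero])
  exact ⟨s, glue_hom_ext (by simp [ht]) (by simp [hs])⟩

lemma isSES_inr_toTwo : IsSES D.inr D.toTwo := by
  have := D.hab.mono
  have := D.hab.epi
  have : Mono D.inr := inferInstanceAs (Mono (pushout.inr D.a D.e))
  have : Epi (D.inl ≫ D.toTwo) := by rw [D.inl_toTwo]; infer_instance
  have : Epi D.toTwo := epi_of_epi D.inl _
  refine IsSES.of_desc D.inr_toTwo fun t ht => ?_
  obtain ⟨s, hs⟩ := D.hab.exists_desc (D.inl ≫ t) (by
    rw [a_inl_assoc, ht, comp_zero])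
  exact ⟨s, glue_hom_ext (by simp [hs]) (by simp [ht])⟩

variable {D} in
lemma Completes.isSES_desc {f : N ⟶ E} {g : E ⟶ M} {f' : X ⟶ E} {g' : E ⟶ X'}
    (hD : D.Completes f g f' g') (hfg : IsSES f g) : IsSES (D.desc f f' hD.af) (g ≫ D.d) := by
  have := hfg.epi
  have := hfg.mono
  have := D.hcd.epi
  have := D.hcd.mono
  have := D.heh.epi
  have hug : D.desc f f' hD.af ≫ g = D.toThree ≫ D.c :=
    glue_hom_ext (by simp [hfg.zero]) (by simp [hD.fg'])
  have : Mono (D.desc f f' hD.af) := Preadditive.mono_of_cancel_zero _ fun t ht => by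
    obtain ⟨s, rfl⟩ := D.isSES_inl_toThree.exists_lift t (by
      rw [← cancel_mono D.c, Category.assoc, ← hug, reassoc_of% ht, zero_comp, zero_comp])
    rw [Category.assoc, inl_desc] at ht
    rw [(cancel_mono f).1 (ht.trans zero_comp.symm), zero_comp]
  refine IsSES.of_desc (by rw [reassoc_of% hug, D.hcd.zero, comp_zero]) fun t ht => ?_
  obtain ⟨r, rfl⟩ := hfg.exists_desc t (by rw [← D.inl_desc f f' hD.af, Category.assoc, ht, comp_zero])
  obtain ⟨s, rfl⟩ := D.hcd.exists_desc r (by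
    rw [← cancel_epi D.h, ← Category.assoc, ← hD.fg', Category.assoc,
      ← D.inr_desc f f' hD.af, Category.assoc, ht, comp_zero, comp_zero])
  exact ⟨s, by simp⟩

lemma isSES_of_glue {N' M' X₃' P X₄' : C} {i : N' ⟶ P} {p : P ⟶ X₃'} {c : X₃' ⟶ M'} {d : M' ⟶ X₄'}
    {u : P ⟶ E} {w : E ⟶ X₄'} {g : E ⟶ M'} (hip : IsSES i p) (hcd : IsSES c d) (huw : IsSES u w)
    (hug : u ≫ g = p ≫ c) (hgd : g ≫ d = w) : IsSES (i ≫ u) g := by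
  have := hip.mono
  have := hip.epi
  have := hcd.mono
  have := huw.mono
  have := huw.epi
  have : Epi g := Preadditive.epi_of_cancel_zero _ fun t ht => by
    obtain ⟨r, rfl⟩ := hcd.exists_desc t (by
      rw [← cancel_epi p, ← Category.assoc, ← hug, Category.assoc, ht, comp_zero, comp_zero])
    rw [reassoc_of% hgd] at ht
    rw [(cancel_epi w).1 (ht.trans comp_zero.symm), comp_zero]
  refine IsSES.of_lift (by rw [Category.assoc, hug, reassoc_of% hip.zero, zero_comp]) fun t ht => ?_
  obtain ⟨s, rfl⟩ := huw.exists_lift t (by rw [← hgd, reassoc_of% ht, zero_comp])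
  obtain ⟨r, rfl⟩ := hip.exists_lift s (by
    rw [← cancel_mono c, Category.assoc, ← hug, ← Category.assoc, ht, zero_comp])
  exact ⟨r, by simp⟩

/-- A completion of a frame to a `3 × 3` diagram with prescribed middle row. -/
@[ext]
structure Completion (f : N ⟶ E) (g : E ⟶ M) : Type v where
  f' : X ⟶ E
  g' : E ⟶ X'
  isSES : IsSES f' g'
  completes : D.Completes f g f' g'

/-- A completion of a frame to a `3 × 3` diagram with prescribed extension
of `X₄` by the pushout `D.glue`. -/
@[ext]
structure CoCompletion (u : D.glue ⟶ E) (w : E ⟶ X₄) : Type v where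
  g : E ⟶ M
  g' : E ⟶ X'
  ug : u ≫ g = D.toThree ≫ D.c
  gd : g ≫ D.d = w
  ug' : u ≫ g' = D.toTwo ≫ D.m
  gn : g' ≫ D.n = w

variable {D}

/-- The extension of `M` by `N` read off from a completion. -/
@[simps]
noncomputable def Completion.toCo {f : N ⟶ E} {g : E ⟶ M} {u : D.glue ⟶ E'} {w : E' ⟶ X₄} (hfg : IsSES f g)
    (p : D.Completion f g) (φ : E ≅ E') (hu : D.desc f p.f' p.completes.af ≫ φ.hom = u)
    (hw : φ.hom ≫ w = g ≫ D.d) : D.CoCompletion u w where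
  g := φ.inv ≫ g
  g' := φ.inv ≫ p.g'
  ug := by
    rw [← hu]
    exact glue_hom_ext (by simp [hfg.zero]) (by simp [p.completes.fg'])
  gd := by simp [← hw]
  ug' := by
    rw [← hu]
    exact glue_hom_ext (by simp [p.completes.gf']) (by simp [p.isSES.zero])
  gn := by simp [← p.completes.gd, ← hw]

/-- The extension of `X'` by `X` read off from a completion. -/
@[simps]
noncomputable def CoCompletion.ofCo {f : N ⟶ E} {g : E ⟶ M} {u : D.glue ⟶ E'} {w : E' ⟶ X₄} (huw : IsSES u w)
    (p : D.CoCompletion u w) (φ : E ≅ E') (hf : f ≫ φ.hom = D.inl ≫ u)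
    (hg : φ.hom ≫ p.g = g) : D.Completion f g where
  f' := D.inr ≫ u ≫ φ.inv
  g' := φ.hom ≫ p.g'
  isSES := by
    simpa using (isSES_of_glue D.isSES_inr_toTwo D.hmn huw p.ug' p.gn).comp_iso φ.symm
  completes :=
    have h₁ : f = D.inl ≫ u ≫ φ.inv := by rw [← reassoc_of% hf]; simp
    { af := by rw [h₁, a_inl_assoc]
      gd := by rw [← hg]; simp [p.gd, p.gn]
      fg' := by rw [← hg]; simp [p.ug]
      gf' := by rw [h₁]; simp [p.ug'] }

variable (D)

/-- Both kinds of completions, together with an identification of the middle terms, carry the same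
information. -/
noncomputable def completionEquiv {f : N ⟶ E} {g : E ⟶ M} {u : D.glue ⟶ E'} {w : E' ⟶ X₄} (hfg : IsSES f g)
    (huw : IsSES u w) :
    {p : D.Completion f g × (E ≅ E') // D.desc f p.1.f' p.1.completes.af ≫ p.2.hom = u ∧
      p.2.hom ≫ w = g ≫ D.d} ≃
    {p : D.CoCompletion u w × (E ≅ E') // f ≫ p.2.hom = D.inl ≫ u ∧ p.2.hom ≫ p.1.g = g} where
  toFun p := ⟨(p.1.1.toCo hfg p.1.2 p.2.1 p.2.2, p.1.2), by
    have := D.inl ≫= p.2.1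
    rwa [inl_desc_assoc] at this, by simp⟩
  invFun p := ⟨(p.1.1.ofCo huw p.1.2 p.2.1 p.2.2, p.1.2), by
    refine glue_hom_ext ?_ (by simp)
    rw [inl_desc_assoc, p.2.1], by
    have := p.2.2 =≫ D.d
    rwa [Category.assoc, p.1.1.gd] at this⟩
  left_inv p := by
    obtain ⟨⟨p, φ⟩, hu, hw⟩ := p
    refine Subtype.ext (Prod.ext (Completion.ext ?_ ?_) rfl)
    · have := D.inr ≫= hu
      dsimp only at this
      rw [inr_desc_assoc] at this
      simp [← reassoc_of% this]
    · simp
  right_inv p := by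
    obtain ⟨⟨p, φ⟩, hf, hg⟩ := p
    refine Subtype.ext (Prod.ext (CoCompletion.ext ?_ ?_) rfl)
    · dsimp only at hg
      simp [← hg]
    · simp

section Counting

lemma natCard_subtype_prod {α β : Type*} [Fintype α] [Finite β] (p : α → β → Prop) :
    Nat.card {x : α × β // p x.1 x.2} = ∑ a, Nat.card {b // p a b} := by
  rw [Nat.card_congr (Equiv.subtypeProdEquivSigmaSubtype p), Nat.card_sigma]

variable [HasExt.{w} C]

lemma finite_completion (hfin : IsFinitary.{w} C) (f : N ⟶ E) (g : E ⟶ M) :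
    Finite (D.Completion f g) := by
  have := hfin.finite_hom X E
  have := hfin.finite_hom E X'
  exact Finite.of_injective (fun p => (p.f', p.g')) fun p q h =>
    Completion.ext (congrArg Prod.fst h) (congrArg Prod.snd h)

lemma finite_coCompletion (hfin : IsFinitary.{w} C) (u : D.glue ⟶ E) (w : E ⟶ X₄) :
    Finite (D.CoCompletion u w) := by
  have := hfin.finite_hom E M
  have := hfin.finite_hom E X'
  exact Finite.of_injective (fun p => (p.g, p.g')) fun p q h =>
    CoCompletion.ext (congrArg Prod.fst h) (congrArg Prod.snd h)

lemma sum_card_completion_mul [Fintype (Ext.{w} M N 1)] [Fintype (Ext.{w} X₄ D.glue 1)]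
    (hfin : IsFinitary.{w} C) :
    (∑ x : Ext.{w} M N 1, Nat.card (D.Completion (extι x) (extπ x))) * Nat.card (X₄ ⟶ D.glue) =
      (∑ y : Ext.{w} X₄ D.glue 1, Nat.card (D.CoCompletion (extι y) (extπ y))) *
        Nat.card (M ⟶ N) := by
  classical
  have hiso (A B : C) : Finite (A ≅ B) :=
    have := hfin.finite_hom A B
    Finite.of_injective Iso.hom fun _ _ h => Iso.ext h
  have (x : Ext.{w} M N 1) := D.finite_completion hfin (extι x) (extπ x)
  have (y : Ext.{w} X₄ D.glue 1) := D.finite_coCompletion hfin (extι y) (extπ y)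
  have (x : Ext.{w} M N 1) := Fintype.ofFinite (D.Completion (extι x) (extπ x))
  have (y : Ext.{w} X₄ D.glue 1) := Fintype.ofFinite (D.CoCompletion (extι y) (extπ y))
  calc
    _ = ∑ x : Ext.{w} M N 1, ∑ y : Ext.{w} X₄ D.glue 1,
          Nat.card {p : D.Completion (extι x) (extπ x) × (extMid x ≅ extMid y) //
            D.desc (extι x) p.1.f' p.1.completes.af ≫ p.2.hom = extι y ∧
              p.2.hom ≫ extπ y = extπ x ≫ D.d} := by
      rw [Finset.sum_mul]
      refine Finset.sum_congr rfl fun x _ => ?_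
      simp_rw [natCard_subtype_prod (fun (p : D.Completion (extι x) (extπ x)) (φ : extMid x ≅ _) =>
        D.desc (extι x) p.f' p.completes.af ≫ φ.hom = extι _ ∧ φ.hom ≫ extπ _ = extπ x ≫ D.d)]
      rw [Finset.sum_comm]
      simp_rw [(Completion.completes _).isSES_desc (isSES_ext x) |>.sum_card_iso_left]
      simp
    _ = ∑ x : Ext.{w} M N 1, ∑ y : Ext.{w} X₄ D.glue 1,
          Nat.card {p : D.CoCompletion (extι y) (extπ y) × (extMid x ≅ extMid y) //
            extι x ≫ p.2.hom = D.inl ≫ extι y ∧ p.2.hom ≫ p.1.g = extπ x} :=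
      Finset.sum_congr rfl fun x _ => Finset.sum_congr rfl fun y _ =>
        Nat.card_congr (D.completionEquiv (isSES_ext x) (isSES_ext y))
    _ = _ := by
      rw [Finset.sum_comm, Finset.sum_mul]
      refine Finset.sum_congr rfl fun y _ => ?_
      simp_rw [natCard_subtype_prod (fun (p : D.CoCompletion (extι y) (extπ y))
        (φ : extMid _ ≅ extMid y) => extι _ ≫ φ.hom = D.inl ≫ extι y ∧ φ.hom ≫ p.g = extπ _)]
      rw [Finset.sum_comm]
      simp_rw [fun p : D.CoCompletion (extι y) (extπ y) => (isSES_of_glue D.isSES_inl_toThree D.hcd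
        (isSES_ext y) p.ug p.gd).sum_card_iso_right]
      simp

omit [HasExt.{w} C] in
lemma card_coCompletion (u : D.glue ⟶ E) (w : E ⟶ X₄) :
    Nat.card (D.CoCompletion u w) =
      Nat.card {g : E ⟶ M // u ≫ g = D.toThree ≫ D.c ∧ g ≫ D.d = w} *
      Nat.card {g : E ⟶ X' // u ≫ g = D.toTwo ≫ D.m ∧ g ≫ D.n = w} := by
  rw [← Nat.card_prod]
  exact Nat.card_congr
    { toFun := fun p => (⟨p.g, p.ug, p.gd⟩, ⟨p.g', p.ug', p.gn⟩)
      invFun := fun p => ⟨p.1.1, p.2.1, p.1.2.1, p.1.2.2, p.2.2.1, p.2.2.2⟩ }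

lemma card_coCompletion_ext (x : Ext.{w} X₄ D.glue 1) [Decidable
      (x.comp (Ext.mk₀ D.toThree) (add_zero 1) = D.hcd.cls ∧
      x.comp (Ext.mk₀ D.toTwo) (add_zero 1) = D.hmn.cls)] :
    Nat.card (D.CoCompletion (extι x) (extπ x)) =
      if x.comp (Ext.mk₀ D.toThree) (add_zero 1) = D.hcd.cls ∧
        x.comp (Ext.mk₀ D.toTwo) (add_zero 1) = D.hmn.cls
      then Nat.card (X₄ ⟶ X₃) * Nat.card (X₄ ⟶ X₂) else 0 := by
  have hx := isSES_ext x
  split_ifs with h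
  · rw [D.card_coCompletion]
    congr 1
    · simpa using hx.card_hom D.hcd D.toThree (𝟙 _) (by rw [cls_isSES_ext, h.1, Ext.mk₀_id_comp])
    · simpa using hx.card_hom D.hmn D.toTwo (𝟙 _) (by rw [cls_isSES_ext, h.2, Ext.mk₀_id_comp])
  · have : IsEmpty (D.CoCompletion (extι x) (extπ x)) := ⟨fun p => h ⟨by
      simpa [cls_isSES_ext] using hx.cls_naturality D.hcd (β := 𝟙 _) p.ug (by simpa using p.gd), by
      simpa [cls_isSES_ext] using hx.cls_naturality D.hmn (β := 𝟙 _) p.ug' (by simpa using p.gn)⟩⟩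
    exact Nat.card_of_isEmpty

lemma sum_card_coCompletion_mul [Fintype (Ext.{w} X₄ D.glue 1)] (hher : IsHereditary.{w} C) :
    (∑ y : Ext.{w} X₄ D.glue 1, Nat.card (D.CoCompletion (extι y) (extπ y))) *
        (Nat.card (Ext.{w} X₄ X₃ 1) * Nat.card (Ext.{w} X₄ X₂ 1)) =
      Nat.card (Ext.{w} X₄ D.glue 1) * (Nat.card (X₄ ⟶ X₃) * Nat.card (X₄ ⟶ X₂)) := by
  classical
  let φ : Ext.{w} X₄ D.glue 1 →+ Ext.{w} X₄ X₃ 1 × Ext.{w} X₄ X₂ 1 :=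
    ((Ext.mk₀ D.toThree).postcomp X₄ (add_zero 1)).prod
      ((Ext.mk₀ D.toTwo).postcomp X₄ (add_zero 1))
  have hφ : Function.Surjective φ := by
    rintro ⟨y₃, y₂⟩
    obtain ⟨x₀, h₀⟩ := D.isSES_inl_toThree.ext_postcomp_surjective hher X₄ y₃
    obtain ⟨x₁, h₁⟩ := D.hab.ext_postcomp_surjective hher X₄
      (y₂ - x₀.comp (Ext.mk₀ D.toTwo) (add_zero 1))
    refine ⟨x₀ + x₁.comp (Ext.mk₀ D.inl) (add_zero 1), Prod.ext ?_ ?_⟩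
    · change Ext.comp _ _ (add_zero 1) = _
      rw [Ext.add_comp, h₀, Ext.comp_assoc_of_third_deg_zero, Ext.mk₀_comp_mk₀, D.inl_toThree,
        Ext.mk₀_zero, Ext.comp_zero, add_zero]
    · change Ext.comp _ _ (add_zero 1) = _
      rw [Ext.add_comp, Ext.comp_assoc_of_third_deg_zero, Ext.mk₀_comp_mk₀, D.inl_toTwo, h₁,
        add_sub_cancel]
  simp_rw [D.card_coCompletion_ext]
  rw [Finset.sum_ite, Finset.sum_const, Finset.sum_const_zero, add_zero, smul_eq_mul,
    ← card_fiber_mul_card φ hφ (D.hcd.cls, D.hmn.cls), Nat.card_prod]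
  have : Nat.card {x // φ x = (D.hcd.cls, D.hmn.cls)} = (Finset.univ.filter
      fun x : Ext.{w} X₄ D.glue 1 => x.comp (Ext.mk₀ D.toThree) (add_zero 1) = D.hcd.cls ∧
        x.comp (Ext.mk₀ D.toTwo) (add_zero 1) = D.hmn.cls).card := by
    rw [Nat.card_eq_fintype_card, Fintype.card_subtype]
    congr 1
    ext x
    simp only [Finset.mem_filter, Finset.mem_univ, true_and]
    exact Prod.ext_iff
  rw [this]
  ring

lemma sum_card_completion [Fintype (Ext.{w} M N 1)] (hfin : IsFinitary.{w} C)
    (hher : IsHereditary.{w} C) :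
    ((∑ x : Ext.{w} M N 1, Nat.card (D.Completion (extι x) (extπ x)) : ℕ) : ℚ) =
      Nat.card (M ⟶ N) * (eulerRatio.{w} X₄ X₁)⁻¹ := by
  have := hfin.finite_ext X₄ D.glue
  have := Fintype.ofFinite (Ext.{w} X₄ D.glue 1)
  have h₁ := D.sum_card_completion_mul hfin
  have h₂ := D.sum_card_coCompletion_mul hher
  have h₃ := hfin.eulerRatio_covariant hher D.isSES_inl_toThree X₄
  have h₄ := hfin.eulerRatio_covariant hher D.hab X₄
  rw [h₄] at h₃
  unfold eulerRatio at h₃ ⊢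
  generalize (∑ x : Ext.{w} M N 1, Nat.card (D.Completion (extι x) (extπ x))) = Z at *
  generalize (∑ y : Ext.{w} X₄ D.glue 1, Nat.card (D.CoCompletion (extι y) (extπ y))) = Z' at *
  have n₁ := hfin.card_hom_ne_zero X₄ X₁
  have n₂ := hfin.card_hom_ne_zero X₄ X₂
  have n₃ := hfin.card_hom_ne_zero X₄ X₃
  have n₄ := hfin.card_hom_ne_zero X₄ D.glue
  have e₁ := hfin.card_ext_ne_zero X₄ X₁
  have e₂ := hfin.card_ext_ne_zero X₄ X₂
  have e₃ := hfin.card_ext_ne_zero X₄ X₃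
  have e₄ := hfin.card_ext_ne_zero X₄ D.glue
  have h₁' := congrArg (Nat.cast (R := ℚ)) h₁
  have h₂' := congrArg (Nat.cast (R := ℚ)) h₂
  push_cast at h₁' h₂'
  have hZ' : (Z' : ℚ) = Nat.card (Ext.{w} X₄ D.glue 1) * (Nat.card (X₄ ⟶ X₃) *
      Nat.card (X₄ ⟶ X₂)) / (Nat.card (Ext.{w} X₄ X₃ 1) * Nat.card (Ext.{w} X₄ X₂ 1)) := by
    rw [← h₂']
    field_simp
  have hZ : (Z : ℚ) = Z' * Nat.card (M ⟶ N) / Nat.card (X₄ ⟶ D.glue) := by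
    rw [← h₁']
    field_simp
  rw [hZ, hZ']
  field_simp at h₃ ⊢
  linear_combination -(Nat.card (M ⟶ N) : ℚ) * h₃

end Counting

end Frame

end HallNumbers

namespace HallNumbers

open Abelian

variable {C : Type u} [Category.{v} C] [Abelian C]

section Classes

variable {N M X X' E : C}

/-- The frames whose corners are the chosen representatives of four isomorphism classes. -/
abbrev OutFrame (N M X X' : C) (c : IsoClass C × IsoClass C × IsoClass C × IsoClass C) : Type v :=
  Frame N M X X' c.1.out c.2.1.out c.2.2.1.out c.2.2.2.out

lemma exists_isoClass_outFrame {f : N ⟶ E} {g : E ⟶ M} {f' : X ⟶ E} {g' : E ⟶ X'}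
    (hfg : IsSES f g) (hfg' : IsSES f' g') :
    ∃ c₀ : IsoClass C × IsoClass C × IsoClass C × IsoClass C, ∀ c,
      (∃ D : OutFrame N M X X' c, D.Completes f g f' g') ↔ c = c₀ := by
  obtain ⟨X₁, X₂, X₃, X₄, D, hD⟩ := Frame.exists_completes hfg hfg'
  have hout (A : C) : Nonempty ((⟦A⟧ : IsoClass C).out ≅ A) :=
    Quotient.mk_out (s := isIsomorphicSetoid C) A
  refine ⟨(⟦X₁⟧, ⟦X₂⟧, ⟦X₃⟧, ⟦X₄⟧), fun c => ⟨?_, ?_⟩⟩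
  · rintro ⟨D', hD'⟩
    obtain ⟨φ₁, φ₂, φ₃, φ₄, -⟩ := hD'.exists_iso hD hfg'.mono hfg'.epi
    obtain ⟨c₁, c₂, c₃, c₄⟩ := c
    have hc (c : IsoClass C) (A : C) (φ : c.out ≅ A) : c = ⟦A⟧ := by
      rw [← Quotient.out_eq c]
      exact Quotient.sound ⟨φ⟩
    rw [hc c₁ X₁ φ₁, hc c₂ X₂ φ₂, hc c₃ X₃ φ₃, hc c₄ X₄ φ₄]
  · rintro rfl
    exact ⟨D.transport (hout X₁).some (hout X₂).some (hout X₃).some (hout X₄).some,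
      hD.transport _ _ _ _⟩

lemma card_outFrame_completes {f : N ⟶ E} {g : E ⟶ M} {f' : X ⟶ E} {g' : E ⟶ X'}
    (hfg' : IsSES f' g') {c : IsoClass C × IsoClass C × IsoClass C × IsoClass C}
    [Decidable (∃ D : OutFrame N M X X' c, D.Completes f g f' g')] :
    Nat.card {D : OutFrame N M X X' c // D.Completes f g f' g'} =
      if ∃ D : OutFrame N M X X' c, D.Completes f g f' g' then
        autCard c.1.out * autCard c.2.1.out * autCard c.2.2.1.out * autCard c.2.2.2.out
      else 0 := by
  split_ifs with h
  · obtain ⟨D, hD⟩ := h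
    exact hD.card_completes hfg'.mono hfg'.epi
  · have : IsEmpty {D : OutFrame N M X X' c // D.Completes f g f' g'} := ⟨fun D => h ⟨D.1, D.2⟩⟩
    exact Nat.card_of_isEmpty

lemma card_frame (X₁ X₂ X₃ X₄ : C) :
    Nat.card (Frame N M X X' X₁ X₂ X₃ X₄) =
      hallNumber X₂ X₁ N * hallNumber X₄ X₃ M * hallNumber X₃ X₁ X * hallNumber X₄ X₂ X' *
        (autCard X₁ * autCard X₂ * autCard X₃ * autCard X₄) ^ 2 := by
  rw [Nat.card_congr (Frame.equivProd N M X X' X₁ X₂ X₃ X₄), Nat.card_prod, Nat.card_prod,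
    Nat.card_prod, card_SES, card_SES, card_SES, card_SES]
  ring

end Classes

variable [HasExt.{w} C]

namespace IsFinitary

variable (hfin : IsFinitary.{w} C)
include hfin

lemma finite_SES (N E M : C) : Finite (SES N E M) :=
  have := hfin.finite_hom N E
  have := hfin.finite_hom E M
  Subtype.finite

lemma finite_frame (N M X X' X₁ X₂ X₃ X₄ : C) : Finite (Frame N M X X' X₁ X₂ X₃ X₄) :=
  have := hfin.finite_SES
  Finite.of_equiv _ (Frame.equivProd N M X X' X₁ X₂ X₃ X₄).symm

lemma autCard_ne_zero (A : C) : (autCard A : ℚ) ≠ 0 := by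
  have := hfin.finite_hom A A
  have : Finite (Aut A) := Finite.of_injective Iso.hom fun _ _ h => Iso.ext h
  have : Nonempty (Aut A) := ⟨Iso.refl A⟩
  exact_mod_cast (Nat.card_pos (α := Aut A)).ne'

end IsFinitary

/-- The summand of Green's formula for extensions of `M` by `N`. -/
noncomputable def greenProd (k : Type t) [Field k] [Linear k C] (N M X X' : C)
    (c : IsoClass C × IsoClass C × IsoClass C × IsoClass C) : ℚ :=
  (Nat.card k : ℚ) ^ (-eulerForm.{t, w} k c.2.2.2.out c.1.out)
    * (hallNumber c.2.2.1.out c.1.out X : ℚ) * (hallNumber c.2.2.2.out c.2.1.out X' : ℚ)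
    * (((autCard c.1.out : ℚ) * (autCard c.2.1.out : ℚ) * (autCard c.2.2.1.out : ℚ)
        * (autCard c.2.2.2.out : ℚ)) / ((autCard X : ℚ) * (autCard X' : ℚ)))
    * ((hallNumber c.2.1.out c.1.out N : ℚ) * (hallNumber c.2.2.2.out c.2.2.1.out M : ℚ))

/-- Green's formula in a finitary hereditary category. -/
theorem green_formula (k : Type t) [Field k] [Finite k] [Linear k C] (hfin : IsFinitary.{w} C)
    (hher : IsHereditary.{w} C) (N M X X' : C) [Fintype (Ext.{w} M N 1)] :
    (Function.support (greenProd.{t, w} k N M X X')).Finite ∧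
    ∑ x : Ext.{w} M N 1, (hallNumber X' X (extMid x) : ℚ) =
      Nat.card (M ⟶ N) * ∑ᶠ c, greenProd.{t, w} k N M X X' c := by
  classical
  have hX := hfin.autCard_ne_zero X
  have hX' := hfin.autCard_ne_zero X'
  have (x : Ext.{w} M N 1) : Fintype (SES X (extMid x) X') :=
    have := hfin.finite_SES X (extMid x) X'
    Fintype.ofFinite _
  choose cl hcl using fun z : (Σ x : Ext.{w} M N 1, SES X (extMid x) X') =>
    exists_isoClass_outFrame (isSES_ext z.1) z.2.2
  have key (c) : (((Finset.univ.filter fun z => cl z = c).card : ℕ) : ℚ) =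
      autCard X * autCard X' * (Nat.card (M ⟶ N) * greenProd.{t, w} k N M X X' c) := by
    have := hfin.finite_frame N M X X' c.1.out c.2.1.out c.2.2.1.out c.2.2.2.out
    have : Fintype (OutFrame N M X X' c) := Fintype.ofFinite _
    have h₁ : (Finset.univ.filter fun z => cl z = c).card *
        (autCard c.1.out * autCard c.2.1.out * autCard c.2.2.1.out * autCard c.2.2.2.out) =
        ∑ D : OutFrame N M X X' c, ∑ x : Ext.{w} M N 1,
          Nat.card (D.Completion (extι x) (extπ x)) := by
      calc
        _ = ∑ z : (Σ x : Ext.{w} M N 1, SES X (extMid x) X'),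
            Nat.card {D : OutFrame N M X X' c //
              D.Completes (extι z.1) (extπ z.1) z.2.1.1 z.2.1.2} := by
          rw [Finset.sum_congr rfl fun z _ => (card_outFrame_completes z.2.2 (c := c)).trans
            (if_congr (hcl z c) rfl rfl)]
          rw [Finset.sum_ite, Finset.sum_const, Finset.sum_const_zero, add_zero, smul_eq_mul]
          simp_rw [eq_comm (a := c)]
        _ = ∑ x : Ext.{w} M N 1, Nat.card {p : SES X (extMid x) X' × OutFrame N M X X' c //
              p.2.Completes (extι x) (extπ x) p.1.1.1 p.1.1.2} := by
          rw [Fintype.sum_sigma]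
          exact Finset.sum_congr rfl fun x _ => (Frame.natCard_subtype_prod
            fun (p : SES X (extMid x) X') (D : OutFrame N M X X' c) =>
              D.Completes (extι x) (extπ x) p.1.1 p.1.2).symm
        _ = ∑ x : Ext.{w} M N 1, ∑ D : OutFrame N M X X' c,
              Nat.card (D.Completion (extι x) (extπ x)) := by
          refine Finset.sum_congr rfl fun x _ => ?_
          have (D : OutFrame N M X X' c) := D.finite_completion hfin (extι x) (extπ x)
          rw [← Nat.card_sigma]
          exact Nat.card_congr
            { toFun := fun p => ⟨p.1.2, ⟨p.1.1.1.1, p.1.1.1.2, p.1.1.2, p.2⟩⟩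
              invFun := fun p => ⟨(⟨(p.2.f', p.2.g'), p.2.isSES⟩, p.1), p.2.completes⟩ }
        _ = _ := Finset.sum_comm
    have h₂ := congrArg (Nat.cast (R := ℚ)) h₁
    rw [Nat.cast_sum] at h₂
    simp_rw [Frame.sum_card_completion _ hfin hher] at h₂
    rw [Finset.sum_const, Finset.card_univ, ← Nat.card_eq_fintype_card, card_frame,
      nsmul_eq_mul] at h₂
    push_cast at h₂
    have a₁ := hfin.autCard_ne_zero c.1.out
    have a₂ := hfin.autCard_ne_zero c.2.1.out
    have a₃ := hfin.autCard_ne_zero c.2.2.1.out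
    have a₄ := hfin.autCard_ne_zero c.2.2.2.out
    rw [greenProd, zpow_neg, hfin.card_zpow_eulerForm]
    refine mul_right_cancel₀ (mul_ne_zero (mul_ne_zero (mul_ne_zero a₁ a₂) a₃) a₄) (h₂.trans ?_)
    field_simp
  have hM := hfin.card_hom_ne_zero M N
  have hsupp : Function.support (greenProd.{t, w} k N M X X') ⊆ (Finset.univ.image cl : Finset _) := by
    intro c hc
    by_contra hc'
    refine hc ?_
    have h0 : (Finset.univ.filter fun z => cl z = c).card = 0 := by
      rw [Finset.card_eq_zero, Finset.filter_eq_empty_iff]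
      exact fun z _ hz => hc' (by simpa using ⟨z.1, z.2, hz⟩)
    have := key c
    rw [h0, Nat.cast_zero] at this
    simpa [hX, hX', hM] using this.symm
  refine ⟨(Finset.finite_toSet _).subset hsupp, ?_⟩
  rw [finsum_eq_sum_of_support_subset _ hsupp, Finset.mul_sum]
  have hcard := Finset.card_eq_sum_card_image cl Finset.univ
  rw [Finset.card_univ, ← Nat.card_eq_fintype_card, Nat.card_sigma] at hcard
  replace hcard := congrArg (Nat.cast (R := ℚ)) hcard
  simp_rw [card_SES] at hcard
  push_cast at hcard
  simp_rw [key] at hcard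
  rw [← Finset.mul_sum, ← Finset.sum_mul, ← Finset.sum_mul] at hcard
  refine mul_left_cancel₀ (mul_ne_zero hX hX') ?_
  rw [← hcard]
  ring

end HallNumbers

namespace HallNumbers

open Abelian

variable {C : Type u} [Category.{v} C] [Abelian C]

lemma isSES_biprod (N M : C) : IsSES (biprod.inl : N ⟶ N ⊞ M) biprod.snd :=
  IsSES.of_lift (by simp) fun t ht => ⟨t ≫ biprod.fst, by
    apply biprod.hom_ext <;> simp [ht]⟩

variable [HasExt.{w} C]

namespace IsSES

variable {N E M : C} {f : N ⟶ E} {g : E ⟶ M}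

lemma cls_eq_zero_of_section (h : IsSES f g) (s : M ⟶ E) (hs : s ≫ g = 𝟙 M) :
    h.cls = (0 : Ext.{w} M N 1) := by
  rw [← Ext.mk₀_id_comp h.cls, ← hs, ← Ext.mk₀_comp_mk₀_assoc, h.comp_cls_g, Ext.comp_zero]

lemma exists_section_of_cls_eq_zero (h : IsSES f g) (hc : h.cls = (0 : Ext.{w} M N 1)) :
    ∃ s : M ⟶ E, s ≫ g = 𝟙 M := by
  obtain ⟨y, hy⟩ := Ext.covariant_sequence_exact₃ M h.shortExact (Ext.mk₀ (𝟙 M)) (zero_add 1) (by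
    change (Ext.mk₀ (𝟙 M)).comp h.cls _ = 0
    rw [hc, Ext.comp_zero])
  obtain ⟨s, rfl⟩ := (Ext.mk₀_bijective _ _).2 y
  rw [Ext.mk₀_comp_mk₀] at hy
  exact ⟨s, (Ext.mk₀_bijective _ _).1 hy⟩

end IsSES

lemma nonempty_extMid_zero_iso (N M : C) : Nonempty (extMid (0 : Ext.{w} M N 1) ≅ N ⊞ M) :=
  (isSES_ext _).nonempty_iso (isSES_biprod N M) (by
    rw [cls_isSES_ext, (isSES_biprod N M).cls_eq_zero_of_section biprod.inr (by simp)])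

section Linear

variable {k : Type t} [Field k] [Linear k C]

lemma nonempty_extMid_smul_iso {N E M : C} {f : N ⟶ E} {g : E ⟶ M} (h : IsSES f g) {b : k}
    (hb : b ≠ 0) : Nonempty (extMid (b • (h.cls : Ext.{w} M N 1)) ≅ E) := by
  let e : M ≅ M :=
    { hom := b⁻¹ • 𝟙 M
      inv := b • 𝟙 M
      hom_inv_id := by simp [smul_smul, hb]
      inv_hom_id := by simp [smul_smul, hb] }
  have h' := h.iso_ends (Iso.refl N) e
  have := h.cls_naturality h' (α := 𝟙 N) (β := e.hom) (φ := 𝟙 E) (by simp) (by simp)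
  refine (isSES_ext _).nonempty_iso h' ?_
  rw [cls_isSES_ext]
  have he : Ext.mk₀ e.hom = b⁻¹ • Ext.mk₀.{w} (𝟙 M) := Ext.mk₀_smul ..
  rw [Ext.comp_mk₀_id, he, Ext.smul_comp, Ext.mk₀_id_comp] at this
  rw [this, smul_smul, mul_inv_cancel₀ hb, one_smul]

namespace IsExceptional

variable {E : C} (hE : IsExceptional.{t, w} k E)
include hE

lemma card_hom : Nat.card (E ⟶ E) = Nat.card k :=
  Nat.card_congr hE.end_self.some.toEquiv

lemma id_ne_zero : 𝟙 E ≠ 0 := fun h => by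
  have : (1 : End E) = 0 := h
  let φ := hE.end_self.some
  exact one_ne_zero ((map_one φ).symm.trans ((congrArg φ this).trans (map_zero φ)))

lemma eq_zero_or_eq_id (π : E ⟶ E) (hπ : π ≫ π = π) : π = 0 ∨ π = 𝟙 E := by
  let φ := hE.end_self.some
  let ρ : End E := π
  have h : φ ρ * φ ρ = φ ρ := by
    rw [← map_mul]
    exact congrArg φ hπ
  rcases IsIdempotentElem.iff_eq_zero_or_one.1 h with h | h
  · exact Or.inl (φ.injective (h.trans (map_zero φ).symm))
  · exact Or.inr (φ.injective (h.trans (map_one φ).symm))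

lemma eulerRatio_self [Finite k] : eulerRatio.{w} E E = Nat.card k := by
  have := hE.ext_self
  rw [eulerRatio, hE.card_hom, Nat.card_of_subsingleton (0 : Ext.{w} E E 1), Nat.cast_one, div_one]

end IsExceptional

namespace IsOrthogonalExceptionalPair

variable {E₁ E₂ : C} (hpair : IsOrthogonalExceptionalPair.{t, w} k E₁ E₂)
include hpair

lemma card_hom_fst_snd : Nat.card (E₁ ⟶ E₂) = 1 :=
  have : Subsingleton (E₁ ⟶ E₂) := ⟨fun f g => by rw [hpair.hom_fst_snd f, hpair.hom_fst_snd g]⟩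
  Nat.card_of_subsingleton 0

lemma card_hom_snd_fst : Nat.card (E₂ ⟶ E₁) = 1 :=
  have : Subsingleton (E₂ ⟶ E₁) := ⟨fun f g => by rw [hpair.hom_snd_fst f, hpair.hom_snd_fst g]⟩
  Nat.card_of_subsingleton 0

variable {E : C} (hE : IsExceptional.{t, w} k E) {i : E₂ ⟶ E} {p : E ⟶ E₁} (h : IsSES i p)
include hE h

lemma cls_ne_zero : (h.cls : Ext.{w} E₁ E₂ 1) ≠ 0 := fun h0 => by
  obtain ⟨s, hs⟩ := h.exists_section_of_cls_eq_zero h0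
  rcases hE.eq_zero_or_eq_id (p ≫ s) (by simp [reassoc_of% hs]) with h1 | h1
  · apply hpair.exceptional_fst.id_ne_zero
    rw [← hs, ← Category.comp_id (s ≫ p), ← hs, Category.assoc, reassoc_of% h1, zero_comp,
      comp_zero]
  · have := h.mono
    apply hpair.exceptional_snd.id_ne_zero
    rw [← cancel_mono i, zero_comp, Category.id_comp, ← Category.comp_id i, ← h1,
      reassoc_of% h.zero, zero_comp]

lemma card_ext_fst_snd [Finite k] (hfin : IsFinitary.{w} C) (hher : IsHereditary.{w} C) :
    Nat.card (Ext.{w} E₁ E₂ 1) = Nat.card k := by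
  have := hpair.ext_snd_fst
  have hk : (Nat.card k : ℚ) ≠ 0 := by exact_mod_cast Nat.card_pos.ne'
  have hx := hfin.card_ext_ne_zero E₁ E₂
  have h₁ := hfin.eulerRatio_covariant hher h E
  rw [hE.eulerRatio_self, hfin.eulerRatio_contravariant hher h E₂,
    hfin.eulerRatio_contravariant hher h E₁, hpair.exceptional_fst.eulerRatio_self,
    hpair.exceptional_snd.eulerRatio_self, eulerRatio, eulerRatio, hpair.card_hom_fst_snd,
    hpair.card_hom_snd_fst, Nat.card_of_subsingleton (0 : Ext.{w} E₂ E₁ 1)] at h₁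
  field_simp at h₁
  simpa using h₁

lemma exists_eq_smul_cls [Finite k] (hfin : IsFinitary.{w} C) (hher : IsHereditary.{w} C)
    (x : Ext.{w} E₁ E₂ 1) : ∃ b : k, b • h.cls = x := by
  have := hfin.finite_ext E₁ E₂
  have hinj : Function.Injective fun b : k => b • (h.cls : Ext.{w} E₁ E₂ 1) :=
    smul_left_injective k (hpair.cls_ne_zero hE h)
  exact ((Nat.bijective_iff_injective_and_card _).2
    ⟨hinj, (hpair.card_ext_fst_snd hE h hfin hher).symm⟩).2 x

end IsOrthogonalExceptionalPair

end Linear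

lemma hallNumber_congr_mid (hfin : IsFinitary.{w} C) (A B : C) {M M' : C} (e : M ≅ M') :
    hallNumber A B M = hallNumber A B M' := by
  have h := card_SES_congr_mid B A e
  have hA := hfin.autCard_ne_zero A
  have hB := hfin.autCard_ne_zero B
  rw [card_SES, card_SES, mul_assoc, mul_assoc] at h
  exact mul_right_cancel₀ (by exact_mod_cast mul_ne_zero hA hB) h

end HallNumbers

theorem proposition2p5 {k : Type t} [Field k] [Finite k]
    {C : Type u} [Category.{v} C] [Abelian C] [Linear k C] [HasExt.{w} C]
    (hfin : HallNumbers.IsFinitary.{w} C) (hher : HallNumbers.IsHereditary.{w} C)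
    {E E₁ E₂ : C} (hE : HallNumbers.IsExceptional.{t, w} k E)
    (hpair : HallNumbers.IsOrthogonalExceptionalPair.{t, w} k E₁ E₂)
    (hass : HallNumbers.IsAssociatedTo E₁ E₂ E) (X X' : C) :
    (Function.support (HallNumbers.greenSummand.{t, w} k E₁ E₂ X X')).Finite ∧
    (HallNumbers.hallNumber X' X E : ℚ) =
      (1 / ((Nat.card k : ℚ) - 1)) *
        ∑ᶠ c : HallNumbers.IsoClass C × HallNumbers.IsoClass C ×
            HallNumbers.IsoClass C × HallNumbers.IsoClass C,
          HallNumbers.greenSummand.{t, w} k E₁ E₂ X X' c := by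
  classical
  obtain ⟨i, p, h₀, hS⟩ := hass
  have h : HallNumbers.IsSES i p := ⟨h₀, hS⟩
  have := hfin.finite_ext E₁ E₂
  have := Fintype.ofFinite (Abelian.Ext.{w} E₁ E₂ 1)
  have := hpair.ext_snd_fst
  have := Fintype.ofSubsingleton (0 : Abelian.Ext.{w} E₂ E₁ 1)
  obtain ⟨hs₁, h₁⟩ := HallNumbers.green_formula k hfin hher E₂ E₁ X X'
  obtain ⟨hs₂, h₂⟩ := HallNumbers.green_formula k hfin hher E₁ E₂ X X'
  have hsum : HallNumbers.greenSummand.{t, w} k E₁ E₂ X X' =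
      fun c => HallNumbers.greenProd.{t, w} k E₂ E₁ X X' c -
        HallNumbers.greenProd.{t, w} k E₁ E₂ X X' c := by
    ext c
    simp only [HallNumbers.greenSummand, HallNumbers.greenTerm, HallNumbers.greenProd]
    ring
  rw [hsum]
  refine ⟨(hs₁.union hs₂).subset (Function.support_sub _ _), ?_⟩
  rw [finsum_sub_distrib hs₁ hs₂]
  rw [hpair.card_hom_fst_snd, Nat.cast_one, one_mul] at h₁
  rw [hpair.card_hom_snd_fst, Nat.cast_one, one_mul, Fintype.sum_subsingleton _ 0] at h₂
  rw [← h₁, ← h₂]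
  obtain ⟨e₁⟩ := HallNumbers.nonempty_extMid_zero_iso.{w} E₂ E₁
  obtain ⟨e₂⟩ := HallNumbers.nonempty_extMid_zero_iso.{w} E₁ E₂
  have hne (x : Abelian.Ext.{w} E₁ E₂ 1) (hx : x ≠ 0) :
      HallNumbers.hallNumber X' X (HallNumbers.extMid x) = HallNumbers.hallNumber X' X E := by
    obtain ⟨b, rfl⟩ := hpair.exists_eq_smul_cls hE h hfin hher x
    have hb : b ≠ 0 := fun hb => hx (by rw [hb, zero_smul])
    exact HallNumbers.hallNumber_congr_mid hfin _ _
      (HallNumbers.nonempty_extMid_smul_iso h hb).some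
  rw [← Finset.add_sum_erase _ _ (Finset.mem_univ 0),
    Finset.sum_congr rfl fun x hx => by rw [hne x (Finset.ne_of_mem_erase hx)],
    Finset.sum_const, Finset.card_erase_of_mem (Finset.mem_univ 0), Finset.card_univ,
    ← Nat.card_eq_fintype_card, hpair.card_ext_fst_snd hE h hfin hher,
    HallNumbers.hallNumber_congr_mid hfin X' X (e₁ ≪≫ biprod.braiding _ _ ≪≫ e₂.symm),
    add_sub_cancel_left, nsmul_eq_mul, Nat.cast_sub Nat.card_pos, Nat.cast_one]
  have hk : (Nat.card k : ℚ) - 1 ≠ 0 := by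
    have : 1 < Nat.card k := Finite.one_lt_card
    exact sub_ne_zero.2 (by exact_mod_cast this.ne')
  field_simp
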